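/- Let $V=(V,Y,\mathbf 1)$ be a vertex algebra over $\mathbb C$, i.e. a complex vector space with a linear map $Y(\cdot,x)\colon V\to(\operatorname{End}V)[[x,x^{-1}]]$, $Y(v,x)=\sum_{k\in\mathbb Z}v_kx^{-k-1}$, and a vector $\mathbf 1\in V$ such that $Y(\mathbf 1,x)=\operatorname{id}_V$, $u_k\mathbf 1=\delta_{k,-1}u$ for $k\ge -1$, $u_kv=0$ for $k$ sufficiently large (depending on $u,v$), and the Jacobi identity holds; no conformal vector is assumed. Put $\mathcal D v=v_{-2}\mathbf 1$. Let $g$ be an automorphism of $V$ (a linear automorphism with $g\mathbf 1=\mathbf 1$ and $g(u_kv)=(gu)_k(gv)$ for all $u,v\in V$, $k\in\mathbb Z$) of finite order $T$, and let $V=\bigoplus_{r=0}^{T-1}V^r$ with $V^r=\{v\in V\mid gv=e^{-2\pi\sqrt{-1}\,r/T}v\}$. Let $n\in\frac1T\mathbb N$ (where $0\in\mathbb N$), and write $n=\lfloor n\rfloor+\bar n/T$ with $\bar n\in\{0,\dots,T-1\}$. For $0\le l\le T$ let $\delta_{\bar n}(l)=1$ if $\bar n\ge l$ and $\delta_{\bar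 n}(l)=0$ if $\bar n<l$. Define bilinear operations $\diamond_{g,n}$ and $\bullet_{g,n}$ on $V$ by setting, for $u\in V^r$ ($0\le r\le T-1$) and $v\in V$, $$u\diamond_{g,n}v=\operatorname{Res}_x\frac{e^{x(\delta_{\bar n}(r)+\lfloor n\rfloor+r/T)}}{(e^x-1)^{2\lfloor n\rfloor+\delta_{\bar n}(r)+\delta_{\bar n}(T-r)+1}}\,Y(u,x)v,$$ $$u\bullet_{g,n}v=\sum_{m=0}^{\lfloor n\rfloor}(-1)^m\binom{m+\lfloor n\rfloor}{\lfloor n\rfloor}\operatorname{Res}_x\frac{e^{x(\lfloor n\rfloor+1)}}{(e^x-1)^{\lfloor n\rfloor+m+1}}\,Y(u,x)v\quad\text{if }r=0,\qquad u\bullet_{g,n}v=0\quad\text{if }r>0,$$ and extending linearly in $u$. Let $\tilde O_{g,n}(V)$ be the linear span of all elements $u\diamond_{g,n}v$ and $\mathcal Du$ with $u,v\in V$. Then $\bullet_{g,n}$ induces a well-defined bilinear product on the quotient space $\tilde A_{g,n}(V)=V/\tilde O_{g,n}(V)$, and with this product $\tilde A_{g,n}(V)$ is an associative algebra over $\mathbb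 C$ with identity element $\mathbf 1+\tilde O_{g,n}(V)$. -/

import Mathlib

noncomputable section

/-- A vertex algebra structure on the complex vector space `V`. The vertex operator
`Y(u, x) = ∑ uₙ x^(-n-1)` sends every `v` to a Laurent series in `x` with coefficients in `V`
(Mathlib's `VertexOperator`), so that `uₙ v = 0` for `n` sufficiently large; the mode `uₙ` is
`VertexOperator.ncoeff (Y u) n`. The Jacobi identity is written as the equality, for all
`l m n : ℤ`, of the coefficients of `z₀^(-l-1) z₁^(-m-1) z₂^(-n-1)` of its two sides applied
to `w`; all sums in it are finite. -/
class VertexAlgebra (V : Type*) [AddCommGroup V] [Module ℂ V] where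
  /-- the state-field correspondence -/
  Y : V →ₗ[ℂ] VertexOperator ℂ V
  /-- the vacuum vector -/
  vac : V
  vac_ncoeff : ∀ (n : ℤ) (v : V),
    VertexOperator.ncoeff (Y vac) n v = if n = -1 then v else 0
  ncoeff_vac : ∀ (u : V) (n : ℤ), -1 ≤ n →
    VertexOperator.ncoeff (Y u) n vac = if n = -1 then u else 0
  jacobi : ∀ (u v w : V) (l m n : ℤ),
    (∑ᶠ i : ℕ, ((-1) ^ i * Ring.choose l i : ℤ) •
        VertexOperator.ncoeff (Y u) (m + l - i) (VertexOperator.ncoeff (Y v) (n + i) w))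
      - (∑ᶠ i : ℕ, ((l.negOnePow : ℤ) * (-1) ^ i * Ring.choose l i : ℤ) •
        VertexOperator.ncoeff (Y v) (n + l - i) (VertexOperator.ncoeff (Y u) (m + i) w))
      = ∑ᶠ i : ℕ, (Ring.choose m i : ℤ) •
        VertexOperator.ncoeff (Y (VertexOperator.ncoeff (Y u) (l + i) v)) (m + n - i) w

namespace VertexAlgebra

section Residue

variable {V : Type*} [AddCommGroup V] [Module ℂ V]

/-- `Res_x f(x) A(x)` for a scalar Laurent series `f` and a Laurent series `A` with
coefficients in `V`. -/
def res (f : LaurentSeries ℂ) (A : HahnModule ℤ ℂ V) : V :=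
  ((HahnModule.of ℂ).symm (f • A)).coeff (-1)

/-- The Laurent series `e^(a x) / (e^x - 1)^k`, computed in the field `ℂ((x))`. -/
def expQuot (a : ℂ) (k : ℕ) : LaurentSeries ℂ :=
  HahnSeries.ofPowerSeries ℤ ℂ (PowerSeries.rescale a (PowerSeries.exp ℂ)) /
    (HahnSeries.ofPowerSeries ℤ ℂ (PowerSeries.exp ℂ - 1)) ^ k

end Residue

section Index

/-- `δ_k(l)`, equal to `1` if `k ≥ l` and to `0` if `k < l`. -/
def delta (k l : ℕ) : ℕ := if l ≤ k then 1 else 0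

/-- For `n ∈ (1/T)ℕ`, the unique `n̄ ∈ {0, …, T-1}` such that `n = ⌊n⌋ + n̄/T`. -/
def nbar (T : ℕ) (n : ℚ) : ℕ := ⌊(T : ℚ) * (n - ⌊n⌋₊)⌋₊

theorem nbar_spec {T : ℕ} (hT : 0 < T) {n : ℚ} (hn : ∃ k : ℕ, n = k / T) :
    nbar T n < T ∧ n = ⌊n⌋₊ + (nbar T n : ℚ) / T := by
  obtain ⟨k, rfl⟩ := hn
  have hT' : (T : ℚ) ≠ 0 := by exact_mod_cast hT.ne'
  have h1 : ⌊(k : ℚ) / T⌋₊ = k / T := Nat.floor_div_eq_div k T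
  have h2 : (k : ℚ) = T * (k / T : ℕ) + (k % T : ℕ) := by
    exact_mod_cast (Nat.div_add_mod k T).symm
  have h3 : (T : ℚ) * ((k : ℚ) / T - (k / T : ℕ)) = (k % T : ℕ) := by
    rw [mul_sub, mul_div_cancel₀ _ hT']
    linarith
  have h4 : nbar T ((k : ℚ) / T) = k % T := by
    rw [nbar, h1, h3, Nat.floor_natCast]
  refine ⟨h4 ▸ Nat.mod_lt k hT, ?_⟩
  rw [h4, h1]
  field_simp
  linarith

end Index

variable {V : Type*} [AddCommGroup V] [Module ℂ V]

/-- `e^(-2π√-1 r/T)` -/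
def rootOfUnity (T r : ℕ) : ℂ := Complex.exp (-(2 * Real.pi * Complex.I * r / T))

/-- `V^r = {v | g v = e^(-2π√-1 r/T) v}` -/
def gradedPiece (g : V ≃ₗ[ℂ] V) (T r : ℕ) : Submodule ℂ V :=
  Module.End.eigenspace (g : V →ₗ[ℂ] V) (rootOfUnity T r)

/-- The projection `(1/T) ∑_{k<T} e^(2π√-1 rk/T) g^k` of `V = ⨁_{r<T} V^r` onto `V^r`,
for `g` with `g^T = 1`. -/
def proj (g : V ≃ₗ[ℂ] V) (T r : ℕ) : V →ₗ[ℂ] V :=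
  (T : ℂ)⁻¹ • ∑ k ∈ Finset.range T, ((rootOfUnity T r)⁻¹ ^ k) • ((g : V →ₗ[ℂ] V) ^ k)

theorem proj_of_mem (g : V ≃ₗ[ℂ] V) {T r s : ℕ} (hr : r < T) (hs : s < T) {u : V}
    (hu : u ∈ gradedPiece g T s) : proj g T r u = if r = s then u else 0 := by
  have hT : T ≠ 0 := by omega
  have hT' : (T : ℂ) ≠ 0 := by exact_mod_cast hT
  have hz : ∀ t : ℕ, rootOfUnity T t = (Complex.exp (2 * Real.pi * Complex.I / T))⁻¹ ^ t := by
    intro t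
    rw [rootOfUnity, ← Complex.exp_neg, ← Complex.exp_nat_mul]
    congr 1
    ring
  have hprim := Complex.isPrimitiveRoot_exp T hT
  have hgu : (g : V →ₗ[ℂ] V) u = rootOfUnity T s • u := Module.End.mem_eigenspace_iff.mp hu
  have hpow : ∀ k : ℕ, ((g : V →ₗ[ℂ] V) ^ k) u = (rootOfUnity T s) ^ k • u := by
    intro k
    induction k with
    | zero => simp
    | succ k ih => rw [pow_succ', Module.End.mul_apply, ih, map_smul, hgu, smul_smul, pow_succ]
  have hne : ∀ t, rootOfUnity T t ≠ 0 := fun t => Complex.exp_ne_zero _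
  have hT1 : ∀ t, rootOfUnity T t ^ T = 1 := by
    intro t
    rw [hz, pow_right_comm, inv_pow, hprim.pow_eq_one, inv_one, one_pow]
  have key : proj g T r u =
      ((T : ℂ)⁻¹ * ∑ k ∈ Finset.range T, ((rootOfUnity T r)⁻¹ * rootOfUnity T s) ^ k) • u := by
    simp only [proj, LinearMap.smul_apply, LinearMap.sum_apply, hpow, smul_smul, ← mul_pow,
      ← Finset.sum_smul]
  rw [key]
  split_ifs with h
  · subst h
    simp [inv_mul_cancel₀ (hne r), hT']
  · have hq : (rootOfUnity T r)⁻¹ * rootOfUnity T s ≠ 1 := by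
      intro hq
      have he : rootOfUnity T s = rootOfUnity T r := by
        have := congrArg (rootOfUnity T r * ·) hq
        simpa [mul_inv_cancel_left₀ (hne r)] using this
      rw [hz, hz, inv_pow, inv_pow, inv_inj] at he
      exact h (hprim.pow_inj hs hr he).symm
    rw [geom_sum_eq hq, mul_pow, inv_pow, hT1, hT1]
    simp

theorem sum_proj (g : V ≃ₗ[ℂ] V) {T : ℕ} (hT : 0 < T) (u : V) :
    ∑ r ∈ Finset.range T, proj g T r u = u := by
  have hT' : (T : ℂ) ≠ 0 := by exact_mod_cast hT.ne'
  have hprim := Complex.isPrimitiveRoot_exp T hT.ne'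
  have hz : ∀ t k : ℕ, (rootOfUnity T t)⁻¹ ^ k =
      (Complex.exp (2 * Real.pi * Complex.I / T) ^ k) ^ t := by
    intro t k
    rw [rootOfUnity, ← Complex.exp_neg, ← Complex.exp_nat_mul, ← Complex.exp_nat_mul,
      ← Complex.exp_nat_mul]
    congr 1
    ring
  simp only [proj, LinearMap.smul_apply, LinearMap.sum_apply, ← Finset.smul_sum, hz]
  rw [Finset.sum_comm]
  simp only [← Finset.sum_smul]
  rw [Finset.sum_eq_single 0]
  · simp [smul_smul, hT']
  · intro k hk hk0
    have h1 : Complex.exp (2 * Real.pi * Complex.I / T) ^ k ≠ 1 :=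
      hprim.pow_ne_one_of_pos_of_lt hk0 (Finset.mem_range.mp hk)
    rw [geom_sum_eq h1, pow_right_comm, hprim.pow_eq_one]
    simp
  · intro h
    exact absurd (Finset.mem_range.mpr hT) h

theorem proj_mem (g : V ≃ₗ[ℂ] V) {T : ℕ} (hg : g ^ T = 1) (r : ℕ) (u : V) :
    proj g T r u ∈ gradedPiece g T r := by
  have hne : rootOfUnity T r ≠ 0 := Complex.exp_ne_zero _
  have hgT : ((g : V →ₗ[ℂ] V) ^ T) u = u := by
    have hc : ∀ k : ℕ, ((g : V →ₗ[ℂ] V) ^ k) u = (g ^ k) u := by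
      intro k
      induction k with
      | zero => simp
      | succ k ih => rw [pow_succ', pow_succ', Module.End.mul_apply, ih]; rfl
    rw [hc, hg]
    rfl
  have hT1 : (rootOfUnity T r)⁻¹ ^ T = 1 := by
    rcases Nat.eq_zero_or_pos T with h0 | h0
    · simp [h0]
    · have hT' : (T : ℂ) ≠ 0 := by exact_mod_cast h0.ne'
      rw [rootOfUnity, ← Complex.exp_neg, ← Complex.exp_nat_mul,
        show (T : ℂ) * - -(2 * Real.pi * Complex.I * r / T) = r * (2 * Real.pi * Complex.I) by
          field_simp]
      exact Complex.exp_nat_mul_two_pi_mul_I r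
  rw [gradedPiece, Module.End.mem_eigenspace_iff]
  set q := (rootOfUnity T r)⁻¹ with hq
  have hq' : rootOfUnity T r = q⁻¹ := by simp [hq]
  have hq0 : q ≠ 0 := inv_ne_zero hne
  rw [hq', eq_inv_smul_iff₀ hq0]
  simp only [proj, LinearMap.smul_apply, LinearMap.sum_apply, map_smul, map_sum, ← hq]
  rw [smul_comm, Finset.smul_sum]
  congr 1
  have hstep : ∀ k : ℕ, q • q ^ k • (g : V →ₗ[ℂ] V) (((g : V →ₗ[ℂ] V) ^ k) u) =
      q ^ (k + 1) • ((g : V →ₗ[ℂ] V) ^ (k + 1)) u := by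
    intro k
    rw [smul_smul, pow_succ' q, pow_succ' (g : V →ₗ[ℂ] V), Module.End.mul_apply]
  simp only [hstep]
  have h1 := Finset.sum_range_succ (fun k => q ^ k • ((g : V →ₗ[ℂ] V) ^ k) u) T
  have h2 := Finset.sum_range_succ' (fun k => q ^ k • ((g : V →ₗ[ℂ] V) ^ k) u) T
  rw [h1] at h2
  simp only [hT1, hgT, pow_zero, one_smul, Module.End.one_apply] at h2
  exact (add_right_cancel h2).symm

variable [VertexAlgebra V]

/-- An automorphism of the vertex algebra `V`. -/
structure IsAutomorphism (g : V ≃ₗ[ℂ] V) : Prop where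
  map_vac : g (vac : V) = vac
  map_ncoeff : ∀ (u v : V) (n : ℤ),
    g (VertexOperator.ncoeff (Y u) n v) = VertexOperator.ncoeff (Y (g u)) n (g v)

variable (V) in
/-- `𝒟 v = v₋₂ 𝟏` -/
def D (v : V) : V := VertexOperator.ncoeff (Y v) (-2) vac

/-- `u ◇_{g,n} v` for `u ∈ V^r`, namely
`Res_x e^(x(δ_n̄(r)+⌊n⌋+r/T)) / (e^x-1)^(2⌊n⌋+δ_n̄(r)+δ_n̄(T-r)+1) Y(u,x)v`. -/
def diamondHom (T : ℕ) (n : ℚ) (r : ℕ) (u v : V) : V :=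
  res (expQuot (delta (nbar T n) r + ⌊n⌋₊ + r / T)
    (2 * ⌊n⌋₊ + delta (nbar T n) r + delta (nbar T n) (T - r) + 1)) (Y u v)

/-- `u •_{g,n} v` for `u ∈ V^0`, namely
`∑_{m=0}^{⌊n⌋} (-1)^m C(m+⌊n⌋,⌊n⌋) Res_x e^(x(⌊n⌋+1)) / (e^x-1)^(⌊n⌋+m+1) Y(u,x)v`. -/
def bulletHom (n : ℚ) (u v : V) : V :=
  ∑ m ∈ Finset.range (⌊n⌋₊ + 1), ((-1) ^ m * (Nat.choose (m + ⌊n⌋₊) ⌊n⌋₊ : ℂ)) •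
    res (expQuot (⌊n⌋₊ + 1) (⌊n⌋₊ + m + 1)) (Y u v)

/-- The operation `◇_{g,n}` on `V`, extended linearly in `u` from the pieces `V^r`. -/
def diamond (g : V ≃ₗ[ℂ] V) (T : ℕ) (n : ℚ) (u v : V) : V :=
  ∑ r ∈ Finset.range T, diamondHom T n r (proj g T r u) v

/-- The operation `•_{g,n}` on `V`, extended linearly in `u` from the pieces `V^r`; it vanishes
for `u ∈ V^r` with `r > 0`. -/
def bullet (g : V ≃ₗ[ℂ] V) (T : ℕ) (n : ℚ) (u v : V) : V :=
  bulletHom n (proj g T 0 u) v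

theorem diamond_of_mem (g : V ≃ₗ[ℂ] V) {T r : ℕ} (hr : r < T) (n : ℚ) {u : V}
    (hu : u ∈ gradedPiece g T r) (v : V) : diamond g T n u v = diamondHom T n r u v := by
  rw [diamond, Finset.sum_eq_single r]
  · rw [proj_of_mem g hr hr hu, if_pos rfl]
  · intro s hs hsr
    rw [proj_of_mem g (Finset.mem_range.mp hs) hr hu, if_neg hsr]
    simp [diamondHom, res]
  · intro h
    exact absurd (Finset.mem_range.mpr hr) h

theorem bullet_of_mem (g : V ≃ₗ[ℂ] V) {T r : ℕ} (hr : r < T) (n : ℚ) {u : V}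
    (hu : u ∈ gradedPiece g T r) (v : V) :
    bullet g T n u v = if r = 0 then bulletHom n u v else 0 := by
  rw [bullet, proj_of_mem g (by omega) hr hu]
  by_cases h : r = 0
  · simp [h]
  · simp [h, Ne.symm h, bulletHom, res]

/-- `Õ_{g,n}(V)`, the span of all `u ◇_{g,n} v` and all `𝒟 u`. -/
def OTilde (g : V ≃ₗ[ℂ] V) (T : ℕ) (n : ℚ) : Submodule ℂ V :=
  Submodule.span ℂ ({x | ∃ u v : V, x = diamond g T n u v} ∪ {x | ∃ u : V, x = D V u})

/-- `Ã_{g,n}(V) = V / Õ_{g,n}(V)` -/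
abbrev ATilde (g : V ≃ₗ[ℂ] V) (T : ℕ) (n : ℚ) : Type _ := V ⧸ OTilde g T n

end VertexAlgebra

end

/-! Everything is computed in the variable t = 1/(e^x - 1), for which dt/dx = -(t + t^2), e^x t = 1
+ t, and x ↦ -x becomes t ↦ -1 - t. Put N = ⌊n⌋. On V^0 the product `•` has kernel K = p(t), where
p' is a multiple of t^N (1+t)^N, p(0) = 1 and p(-1) = 0. Hence p(-1-t) = 1 - p(t), so (1+t)^(N+1)
divides p and t^(N+1) divides p - 1. The kernel of `◇` on V^0 is (t(1+t))^(N+1). Integration by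
parts against 𝒟 puts all its multiples by polynomials in t at one's disposal (`mode_mem_OTilde`),
and both K' and K(K-1) are such multiples.

For 0 < r < T, u ◇ 1 is a nonzero multiple of u modulo 𝒟V, so V^r dies in the quotient
(`gradedPiece_le_OTilde`) and only V^0 matters.

Skew-symmetry modulo 𝒟V rewrites u • v as Res (K-1) Y(v,x)u. Right multiplication by c is therefore
the operator with kernel K - 1 attached to c, and associativity says that it commutes modulo Õ with
left multiplication by a. The commutator formula only produces the kernels K^(i)/i! · (K-1), which
are multiples of the kernel of `◇` (`mode_kernel_commutator_mem`). The same formula shows that Õ is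
stable under left multiplication, and skew-symmetry gives the other side. The vacuum is an identity
because K has residue 1. -/

noncomputable section

/-! ### Calculus on Laurent series: reduction to monomials, derivative, reflection. -/

namespace LaurentSeries

open HahnSeries

/-- A linear map out of Laurent series that vanishes on all series of sufficiently high order. -/
def IsDiscrete {W : Type*} [AddCommGroup W] [Module ℂ W] (φ : LaurentSeries ℂ →ₗ[ℂ] W) : Prop :=
  ∃ M : ℤ, ∀ f : LaurentSeries ℂ, (∀ i < M, f.coeff i = 0) → φ f = 0

namespace IsDiscrete

variable {W W' : Type*} [AddCommGroup W] [Module ℂ W] [AddCommGroup W'] [Module ℂ W']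
  {φ ψ : LaurentSeries ℂ →ₗ[ℂ] W}

theorem add (hφ : IsDiscrete φ) (hψ : IsDiscrete ψ) : IsDiscrete (φ + ψ) := by
  obtain ⟨M, hM⟩ := hφ
  obtain ⟨M', hM'⟩ := hψ
  refine ⟨max M M', fun f hf => ?_⟩
  rw [LinearMap.add_apply, hM f fun i hi => hf i (lt_max_of_lt_left hi),
    hM' f fun i hi => hf i (lt_max_of_lt_right hi), add_zero]

theorem neg (hφ : IsDiscrete φ) : IsDiscrete (-φ) := by
  obtain ⟨M, hM⟩ := hφ
  exact ⟨M, fun f hf => by rw [LinearMap.neg_apply, hM f hf, neg_zero]⟩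

theorem sub (hφ : IsDiscrete φ) (hψ : IsDiscrete ψ) : IsDiscrete (φ - ψ) :=
  sub_eq_add_neg φ ψ ▸ hφ.add hψ.neg

theorem sum {ι : Type*} (s : Finset ι) (φ : ι → LaurentSeries ℂ →ₗ[ℂ] W)
    (h : ∀ i ∈ s, IsDiscrete (φ i)) : IsDiscrete (∑ i ∈ s, φ i) :=
  Finset.sum_induction _ IsDiscrete (fun _ _ => add) ⟨0, fun _ _ => rfl⟩ h

theorem comp (hφ : IsDiscrete φ) (L : W →ₗ[ℂ] W') : IsDiscrete (L ∘ₗ φ) := by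
  obtain ⟨M, hM⟩ := hφ
  exact ⟨M, fun f hf => by rw [LinearMap.comp_apply, hM f hf, map_zero]⟩

theorem comp_of_shift (hφ : IsDiscrete φ) (L : LaurentSeries ℂ →ₗ[ℂ] LaurentSeries ℂ) (s : ℤ)
    (hL : ∀ (f : LaurentSeries ℂ) (M : ℤ), (∀ i < M, f.coeff i = 0) →
      ∀ i < M - s, (L f).coeff i = 0) : IsDiscrete (φ ∘ₗ L) := by
  obtain ⟨M, hM⟩ := hφ
  refine ⟨M + s, fun f hf => hM _ fun i hi => hL f _ hf i (by omega)⟩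

/-- A series differs from a finite combination of monomials by one of order at least M, which φ
kills. This stands in for continuity: identities and memberships need checking only on powers of x.
-/
theorem mem (hφ : IsDiscrete φ) (S : Submodule ℂ W) (hS : ∀ i : ℤ, φ (single i 1) ∈ S)
    (f : LaurentSeries ℂ) : φ f ∈ S := by
  obtain ⟨M, hM⟩ := hφ
  have h0 : φ (f - ∑ i ∈ Finset.Ico f.order M, f.coeff i • single i (1 : ℂ)) = 0 := by
    refine hM _ fun j hj => ?_
    rw [coeff_sub, coeff_sum]
    simp only [coeff_smul, coeff_single, smul_eq_mul, mul_ite, mul_one, mul_zero]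
    rw [Finset.sum_ite_eq]
    split_ifs with h
    · exact sub_self _
    · rw [Finset.mem_Ico] at h
      rw [coeff_eq_zero_of_lt_order (by omega), sub_zero]
  rw [map_sub, sub_eq_zero] at h0
  rw [h0, map_sum]
  exact Submodule.sum_mem _ fun i _ => by rw [map_smul]; exact S.smul_mem _ (hS i)

theorem eq (hφ : IsDiscrete φ) (hψ : IsDiscrete ψ)
    (h : ∀ i : ℤ, φ (single i 1) = ψ (single i 1)) (f : LaurentSeries ℂ) : φ f = ψ f := by
  have := (hφ.sub hψ).mem ⊥ (fun i => by simp [h i]) f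
  rwa [Submodule.mem_bot, LinearMap.sub_apply, sub_eq_zero] at this

end IsDiscrete

/-- The coefficient functional. -/
def coeffLinear (n : ℤ) : LaurentSeries ℂ →ₗ[ℂ] ℂ where
  toFun f := f.coeff n
  map_add' _ _ := rfl
  map_smul' _ _ := rfl

theorem isDiscrete_coeffLinear (n : ℤ) : IsDiscrete (coeffLinear n) :=
  ⟨n + 1, fun _ hf => hf n (by omega)⟩

theorem coeff_mul_eq_zero_of_lt {f : LaurentSeries ℂ} {M : ℤ} (hf : ∀ i < M, f.coeff i = 0)
    (g : LaurentSeries ℂ) : ∀ i < M - -g.order, (f * g).coeff i = 0 := by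
  intro i hi
  rw [coeff_mul]
  refine Finset.sum_eq_zero fun x hx => ?_
  rw [Finset.mem_antidiagonal] at hx
  rcases lt_or_ge x.1 M with h | h
  · rw [hf _ h, zero_mul]
  · rw [coeff_eq_zero_of_lt_order (by omega : x.2 < g.order), mul_zero]

theorem coeff_hasseDeriv_eq_zero_of_lt {f : LaurentSeries ℂ} {M : ℤ}
    (hf : ∀ i < M, f.coeff i = 0) (k : ℕ) :
    ∀ i < M - k, (hasseDeriv ℂ k f).coeff i = 0 := by
  intro i hi
  rw [hasseDeriv_coeff, hf _ (by omega), smul_zero]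

/-- Multiplication by a fixed series. -/
def mulBy (g : LaurentSeries ℂ) : LaurentSeries ℂ →ₗ[ℂ] LaurentSeries ℂ where
  toFun f := f * g
  map_add' f h := add_mul f h g
  map_smul' r f := by
    rw [RingHom.id_apply, ← C_mul_eq_smul, ← C_mul_eq_smul, mul_assoc]

@[simp]
theorem mulBy_apply (f g : LaurentSeries ℂ) : mulBy g f = f * g := rfl

theorem IsDiscrete.comp_mulBy {W : Type*} [AddCommGroup W] [Module ℂ W]
    {φ : LaurentSeries ℂ →ₗ[ℂ] W} (hφ : IsDiscrete φ) (g : LaurentSeries ℂ) :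
    IsDiscrete (φ ∘ₗ mulBy g) :=
  hφ.comp_of_shift _ (-g.order) fun _ _ hf => coeff_mul_eq_zero_of_lt hf g

theorem IsDiscrete.comp_hasseDeriv {W : Type*} [AddCommGroup W] [Module ℂ W]
    {φ : LaurentSeries ℂ →ₗ[ℂ] W} (hφ : IsDiscrete φ) (k : ℕ) :
    IsDiscrete (φ ∘ₗ hasseDeriv ℂ k) :=
  hφ.comp_of_shift _ k fun _ _ hf => coeff_hasseDeriv_eq_zero_of_lt hf k

theorem derivative_single (n : ℤ) :
    derivative ℂ (single n (1 : ℂ)) = single (n - 1) (n : ℂ) := by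
  rw [derivative_apply, hasseDeriv_single, Ring.choose_one_right]
  simp

/-- The product rule. -/
theorem derivative_mul (f g : LaurentSeries ℂ) :
    derivative ℂ (f * g) = derivative ℂ f * g + f * derivative ℂ g := by
  have hd : ∀ (n : ℤ), IsDiscrete (coeffLinear n ∘ₗ derivative ℂ) := fun n =>
    (isDiscrete_coeffLinear n).comp_hasseDeriv 1
  ext n
  refine IsDiscrete.eq (φ := (coeffLinear n ∘ₗ derivative ℂ) ∘ₗ mulBy g)
    (ψ := (coeffLinear n ∘ₗ mulBy g) ∘ₗ derivative ℂ +
      coeffLinear n ∘ₗ mulBy (derivative ℂ g)) ((hd n).comp_mulBy g)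
    ((((isDiscrete_coeffLinear n).comp_mulBy g).comp_hasseDeriv 1).add
      ((isDiscrete_coeffLinear n).comp_mulBy _)) (fun i => ?_) f
  simp only [LinearMap.comp_apply, LinearMap.add_apply, mulBy_apply, ← map_add]
  -- With f already a monomial, swapping the factors lets the same reduction run in g.
  rw [mul_comm, mul_comm _ g, mul_comm _ (derivative ℂ g)]
  refine IsDiscrete.eq
    (φ := (coeffLinear n ∘ₗ derivative ℂ) ∘ₗ mulBy (single i 1))
    (ψ := coeffLinear n ∘ₗ mulBy (derivative ℂ (single i 1)) +
      (coeffLinear n ∘ₗ mulBy (single i 1)) ∘ₗ derivative ℂ)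
    ((hd n).comp_mulBy _) (((isDiscrete_coeffLinear n).comp_mulBy _).add
      (((isDiscrete_coeffLinear n).comp_mulBy _).comp_hasseDeriv 1)) (fun j => ?_) g
  simp only [LinearMap.comp_apply, LinearMap.add_apply, mulBy_apply,
    single_mul_single, derivative_single, mul_one, one_mul, ← map_add]
  congr 1
  rw [show j - 1 + i = j + i - 1 by ring, show j + (i - 1) = j + i - 1 by ring,
    ← single_add, add_comm j i]
  push_cast
  rfl

theorem derivative_one : derivative ℂ (1 : LaurentSeries ℂ) = 0 := by
  rw [← single_zero_one, derivative_single]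
  simp

theorem derivative_pow (f : LaurentSeries ℂ) (k : ℕ) :
    derivative ℂ (f ^ (k + 1)) = (k + 1) * (f ^ k * derivative ℂ f) := by
  induction k with
  | zero => simp
  | succ k ih =>
    rw [pow_succ, derivative_mul, ih]
    push_cast
    ring

theorem coeff_neg_one_derivative (f : LaurentSeries ℂ) : (derivative ℂ f).coeff (-1) = 0 := by
  rw [derivative_apply, hasseDeriv_coeff]
  simp

/-- The substitution `x ↦ -x`. -/
def negVar : LaurentSeries ℂ →ₗ[ℂ] LaurentSeries ℂ where
  toFun f := HahnSeries.ofSuppBddBelow (fun n => (-1 : ℂ) ^ n * f.coeff n) <| by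
    refine ⟨f.order, fun x h => ?_⟩
    contrapose! h
    rw [Function.notMem_support, coeff_eq_zero_of_lt_order h, mul_zero]
  map_add' f g := by
    ext
    simp [HahnSeries.ofSuppBddBelow, mul_add]
  map_smul' r f := by
    ext
    simp only [HahnSeries.ofSuppBddBelow, coeff_smul, RingHom.id_apply, smul_eq_mul]
    ring

theorem coeff_negVar (f : LaurentSeries ℂ) (n : ℤ) :
    (negVar f).coeff n = (-1 : ℂ) ^ n * f.coeff n := rfl

theorem negVar_single (n : ℤ) : negVar (single n 1) = single n ((-1 : ℂ) ^ n) := by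
  ext m
  rw [coeff_negVar, coeff_single, coeff_single]
  split_ifs with h
  · rw [h, mul_one]
  · rw [mul_zero]

theorem IsDiscrete.comp_negVar {W : Type*} [AddCommGroup W] [Module ℂ W]
    {φ : LaurentSeries ℂ →ₗ[ℂ] W} (hφ : IsDiscrete φ) : IsDiscrete (φ ∘ₗ negVar) :=
  hφ.comp_of_shift _ 0 fun f M hf i hi => by rw [coeff_negVar, hf i (by omega), mul_zero]

theorem negVar_one : negVar 1 = 1 := by
  rw [← single_zero_one, negVar_single, zpow_zero]

theorem negVar_mul (f g : LaurentSeries ℂ) : negVar (f * g) = negVar f * negVar g := by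
  ext n
  refine IsDiscrete.eq (φ := (coeffLinear n ∘ₗ negVar) ∘ₗ mulBy g)
    (ψ := (coeffLinear n ∘ₗ mulBy (negVar g)) ∘ₗ negVar)
    ((isDiscrete_coeffLinear n).comp_negVar.comp_mulBy g)
    ((isDiscrete_coeffLinear n).comp_mulBy _).comp_negVar (fun i => ?_) f
  simp only [LinearMap.comp_apply, mulBy_apply]
  rw [mul_comm, mul_comm _ (negVar g)]
  refine IsDiscrete.eq (φ := (coeffLinear n ∘ₗ negVar) ∘ₗ mulBy (single i 1))
    (ψ := (coeffLinear n ∘ₗ mulBy (negVar (single i 1))) ∘ₗ negVar)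
    ((isDiscrete_coeffLinear n).comp_negVar.comp_mulBy _)
    ((isDiscrete_coeffLinear n).comp_mulBy _).comp_negVar (fun j => ?_) g
  simp only [LinearMap.comp_apply, mulBy_apply, single_mul_single, negVar_single,
    mul_one]
  rw [zpow_add₀ (by norm_num)]

theorem negVar_C (a : ℂ) : negVar (C a) = C a := by
  rw [← mul_one (C a), C_mul_eq_smul, map_smul, negVar_one]

/-- The substitution `x ↦ -x` as a ring homomorphism. -/
def negVarHom : LaurentSeries ℂ →+* LaurentSeries ℂ where
  toFun := negVar
  map_one' := negVar_one
  map_mul' := negVar_mul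
  map_zero' := map_zero _
  map_add' := map_add _

/-! ### Exponentials and the variable t = 1/(e^x - 1). -/

/-- The series `e^(ax)`. -/
def expSeries (a : ℂ) : LaurentSeries ℂ :=
  ofPowerSeries ℤ ℂ (PowerSeries.rescale a (PowerSeries.exp ℂ))

theorem coeff_ofPowerSeries_of_neg (f : PowerSeries ℂ) {n : ℤ} (hn : n < 0) :
    (ofPowerSeries ℤ ℂ f).coeff n = 0 := by
  rw [ofPowerSeries_apply]
  apply embDomain_of_notMem_range
  rintro ⟨m, hm⟩
  simp at hm
  omega

theorem derivative_expSeries (a : ℂ) : derivative ℂ (expSeries a) = C a * expSeries a := by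
  ext n
  rw [derivative_apply, hasseDeriv_coeff, C_mul_eq_smul, HahnSeries.coeff_smul, expSeries]
  rcases lt_trichotomy n (-1) with h | h | h
  · rw [coeff_ofPowerSeries_of_neg (n := n) _ (by omega),
      coeff_ofPowerSeries_of_neg (n := n + (1 : ℕ)) _ (by push_cast; omega)]
    simp
  · subst h
    rw [coeff_ofPowerSeries_of_neg (n := -1) _ (by omega)]
    simp
  · obtain ⟨m, rfl⟩ := Int.eq_ofNat_of_zero_le (by omega : 0 ≤ n)
    have : ((m : ℤ) + (1 : ℕ)) = ((m + 1 : ℕ) : ℤ) := by push_cast; rfl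
    rw [Ring.choose_one_right, this, coeff_coe_powerSeries, coeff_coe_powerSeries,
      PowerSeries.coeff_rescale, PowerSeries.coeff_rescale, PowerSeries.coeff_exp,
      PowerSeries.coeff_exp, Nat.factorial_succ]
    have h1 : (m.factorial : ℂ) ≠ 0 := by exact_mod_cast m.factorial_ne_zero
    have h2 : (m : ℂ) + 1 ≠ 0 := by exact_mod_cast m.succ_ne_zero
    simp
    field_simp
    ring

theorem expSeries_zero : expSeries 0 = 1 := by
  simp [expSeries]

theorem expSeries_natCast (k : ℕ) : expSeries k = expSeries 1 ^ k := by
  simp only [expSeries]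
  rw [← PowerSeries.exp_pow_eq_rescale_exp, map_pow]
  simp

theorem negVar_expSeries_mul : expSeries 1 * negVar (expSeries 1) = 1 := by
  have h : negVar (expSeries 1) =
      ofPowerSeries ℤ ℂ (PowerSeries.evalNegHom (PowerSeries.exp ℂ)) := by
    ext n
    rw [coeff_negVar, expSeries]
    rcases lt_or_ge n 0 with h | h
    · rw [coeff_ofPowerSeries_of_neg _ h, coeff_ofPowerSeries_of_neg _ h, mul_zero]
    · obtain ⟨m, rfl⟩ := Int.eq_ofNat_of_zero_le h
      rw [coeff_coe_powerSeries, coeff_coe_powerSeries, PowerSeries.evalNegHom,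
        PowerSeries.coeff_rescale]
      simp
  rw [h, expSeries, ← map_mul, PowerSeries.rescale_one]
  simp [PowerSeries.exp_mul_exp_neg_eq_one]

/-- The series `t = 1 / (e^x - 1)`. -/
def invExpSubOne : LaurentSeries ℂ := (ofPowerSeries ℤ ℂ (PowerSeries.exp ℂ - 1))⁻¹

local notation "τ" => invExpSubOne

theorem ofPowerSeries_exp_sub_one :
    ofPowerSeries ℤ ℂ (PowerSeries.exp ℂ - 1) = expSeries 1 - 1 := by
  simp [expSeries]

theorem expSeries_sub_one_ne_zero : expSeries 1 - 1 ≠ 0 := by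
  rw [← ofPowerSeries_exp_sub_one]
  intro h
  have := congrArg (fun f => f.coeff ((1 : ℕ) : ℤ)) h
  simp only [coeff_coe_powerSeries] at this
  simp [PowerSeries.coeff_one] at this

theorem expSeries_sub_one_mul : (expSeries 1 - 1) * τ = 1 := by
  rw [invExpSubOne, ofPowerSeries_exp_sub_one, mul_inv_cancel₀ expSeries_sub_one_ne_zero]

theorem expSeries_one_mul : expSeries 1 * τ = 1 + τ := by
  linear_combination expSeries_sub_one_mul

theorem derivative_invExpSubOne : derivative ℂ τ = -(τ + τ ^ 2) := by
  have h := congrArg (derivative ℂ) expSeries_sub_one_mul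
  rw [derivative_mul, map_sub, derivative_one, derivative_expSeries, map_one, one_mul, sub_zero] at h
  apply mul_left_cancel₀ expSeries_sub_one_ne_zero
  linear_combination h - expSeries_one_mul + (1 + τ) * expSeries_sub_one_mul

theorem negVarHom_invExpSubOne : negVarHom τ = -1 - τ := by
  have h := congrArg negVarHom expSeries_sub_one_mul
  have h2 : expSeries 1 * negVarHom (expSeries 1) = 1 := negVar_expSeries_mul
  rw [map_mul, map_sub, map_one] at h
  have h3 : (expSeries 1 - 1) * negVarHom τ = - expSeries 1 := by
    linear_combination negVarHom τ * h2 - expSeries 1 * h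
  apply mul_left_cancel₀ expSeries_sub_one_ne_zero
  linear_combination h3 + expSeries_sub_one_mul

theorem expQuot_eq (a : ℂ) (k : ℕ) : VertexAlgebra.expQuot a k = expSeries a * τ ^ k := by
  rw [VertexAlgebra.expQuot, invExpSubOne, expSeries, inv_pow, div_eq_mul_inv]

/-- For integral exponents e^x is absorbed through e^x t = 1 + t, so the series is a polynomial in
t. -/
theorem expQuot_natCast (k j : ℕ) :
    VertexAlgebra.expQuot k (k + j) = (1 + τ) ^ k * τ ^ j := by
  rw [expQuot_eq, expSeries_natCast, _root_.pow_add, ← mul_assoc, ← mul_pow, expSeries_one_mul]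

theorem derivative_expSeries_mul_pow (a : ℂ) (k : ℕ) :
    derivative ℂ (expSeries a * τ ^ k) =
      C (a - k) * (expSeries a * τ ^ k) - C (k : ℂ) * (expSeries a * τ ^ (k + 1)) := by
  rw [derivative_mul, derivative_expSeries]
  cases k with
  | zero => rw [pow_zero, derivative_one]; simp
  | succ k =>
    rw [derivative_pow, derivative_invExpSubOne]
    simp only [map_sub, map_natCast]
    push_cast
    ring

/-- Writing e^x - 1 = x h with h(0) = 1 gives t = x⁻¹ h⁻¹, a simple pole of residue 1. -/
theorem coeff_neg_one_expSeries_mul (a : ℂ) : (expSeries a * τ).coeff (-1) = 1 := by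
  obtain ⟨h, hh⟩ : (PowerSeries.X : PowerSeries ℂ) ∣ PowerSeries.exp ℂ - 1 := by
    rw [PowerSeries.X_dvd_iff]
    simp
  have hc : PowerSeries.constantCoeff h = 1 := by
    have := congrArg (PowerSeries.coeff 1) hh
    rw [mul_comm, show (1 : ℕ) = 0 + 1 from rfl, PowerSeries.coeff_succ_mul_X] at this
    simpa [PowerSeries.coeff_one] using this.symm
  have hu : h * h⁻¹ = 1 := PowerSeries.mul_inv_cancel h (by rw [hc]; exact one_ne_zero)
  have ht : τ = single (-1) 1 * ofPowerSeries ℤ ℂ h⁻¹ := by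
    apply mul_left_cancel₀ expSeries_sub_one_ne_zero
    rw [expSeries_sub_one_mul, ← ofPowerSeries_exp_sub_one, hh, map_mul, ofPowerSeries_X,
      mul_mul_mul_comm, ← map_mul (ofPowerSeries ℤ ℂ), hu, (ofPowerSeries ℤ ℂ).map_one,
      single_mul_single]
    simp
  rw [ht, mul_left_comm, expSeries, ← map_mul, coeff_single_mul, sub_self,
    show (0 : ℤ) = ((0 : ℕ) : ℤ) from rfl, coeff_coe_powerSeries]
  have he : PowerSeries.constantCoeff (PowerSeries.rescale a (PowerSeries.exp ℂ)) = 1 := by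
    rw [← PowerSeries.coeff_zero_eq_constantCoeff_apply, PowerSeries.coeff_rescale]
    simp
  simp [hc, he]

/-- A derivative has no residue; applied to e^(ax) t^(k+1) this is a recursion in the pole order.
Its factor a - (k+1) never vanishes for non-integral a. -/
theorem coeff_neg_one_expSeries_mul_pow_succ (a : ℂ) (k : ℕ) :
    ((k : ℂ) + 1) * (expSeries a * τ ^ (k + 2)).coeff (-1) =
      (a - (k + 1)) * (expSeries a * τ ^ (k + 1)).coeff (-1) := by
  have h := coeff_neg_one_derivative (expSeries a * τ ^ (k + 1))
  rw [derivative_expSeries_mul_pow, coeff_sub, C_mul_eq_smul, C_mul_eq_smul,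
    HahnSeries.coeff_smul, HahnSeries.coeff_smul] at h
  push_cast at h
  simp only [smul_eq_mul] at h
  linear_combination -h

theorem coeff_neg_one_expSeries_mul_pow_ne_zero {a : ℂ} (ha : ∀ j : ℤ, a ≠ j) (k : ℕ) :
    (expSeries a * τ ^ (k + 1)).coeff (-1) ≠ 0 := by
  induction k with
  | zero => rw [zero_add, pow_one, coeff_neg_one_expSeries_mul]; exact one_ne_zero
  | succ k ih =>
    intro h0
    have h := coeff_neg_one_expSeries_mul_pow_succ a k
    rw [h0, mul_zero] at h
    rcases mul_eq_zero.mp h.symm with h | h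
    · exact ha (k + 1) (by push_cast; linear_combination h)
    · exact ih h

/-! ### Polynomials in t. -/

/-- The evaluation of polynomials at `t = 1 / (e^x - 1)`. -/
def evalInv : Polynomial ℂ →+* LaurentSeries ℂ := Polynomial.eval₂RingHom C τ

theorem evalInv_monomial (k : ℕ) (a : ℂ) :
    evalInv (Polynomial.monomial k a) = C a * τ ^ k := Polynomial.eval₂_monomial _ _

theorem evalInv_X : evalInv Polynomial.X = τ := Polynomial.eval₂_X _ _

theorem evalInv_C (a : ℂ) : evalInv (Polynomial.C a) = C a := Polynomial.eval₂_C _ _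

/-- Heuristically, dx = -dt/(t(1+t)) and x = 0 corresponds to t = ∞, so the residue is collected at
the poles t = 0 and t = -1. The proof uses the recursion at a = 0, which gives Res t^(k+1) = (-1)^k.
-/
theorem coeff_neg_one_evalInv (p : Polynomial ℂ) :
    (evalInv p).coeff (-1) = p.eval 0 - p.eval (-1) := by
  have hpow : ∀ k : ℕ, (τ ^ (k + 1)).coeff (-1) = (-1) ^ k := by
    intro k
    induction k with
    | zero =>
      have := coeff_neg_one_expSeries_mul 0
      rw [expSeries_zero, one_mul] at this
      simpa using this
    | succ k ih =>
      have h := coeff_neg_one_expSeries_mul_pow_succ 0 k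
      rw [expSeries_zero, one_mul, one_mul, ih] at h
      have hk : (k : ℂ) + 1 ≠ 0 := by exact_mod_cast k.succ_ne_zero
      apply mul_left_cancel₀ hk
      rw [h]
      ring
  induction p using Polynomial.induction_on' with
  | add p q hp hq =>
    rw [map_add, coeff_add, hp, hq, Polynomial.eval_add, Polynomial.eval_add]
    ring
  | monomial k a =>
    rw [evalInv_monomial, C_mul_eq_smul, HahnSeries.coeff_smul]
    cases k with
    | zero => simp [HahnSeries.coeff_one]
    | succ k =>
      rw [hpow]
      simp [pow_succ]

theorem derivative_evalInv (p : Polynomial ℂ) :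
    derivative ℂ (evalInv p) =
      evalInv (-(Polynomial.X + Polynomial.X ^ 2) * Polynomial.derivative p) := by
  induction p using Polynomial.induction_on' with
  | add p q hp hq => simp only [map_add, hp, hq, mul_add]
  | monomial k a =>
    have h := derivative_expSeries_mul_pow 0 k
    rw [expSeries_zero, one_mul, one_mul] at h
    rw [evalInv_monomial, C_mul_eq_smul, map_smul, h, Polynomial.derivative_monomial,
      ← C_mul_eq_smul]
    cases k with
    | zero => simp
    | succ k =>
      simp only [map_mul, map_neg, map_add, map_pow, evalInv_X, evalInv_monomial,
        Nat.add_sub_cancel, map_sub, map_natCast, map_zero]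
      ring

theorem negVar_evalInv (p : Polynomial ℂ) :
    negVar (evalInv p) = evalInv (p.comp (-1 - Polynomial.X)) := by
  induction p using Polynomial.induction_on' with
  | add p q hp hq => rw [map_add, map_add, hp, hq, Polynomial.add_comp, map_add]
  | monomial k a =>
    have h : negVar (τ ^ k) = (-1 - τ) ^ k := by
      rw [← negVarHom_invExpSubOne, ← map_pow]
      rfl
    rw [evalInv_monomial, negVar_mul, negVar_C, h, Polynomial.monomial_comp, map_mul, evalInv_C,
      map_pow, map_sub, map_neg, map_one, evalInv_X]

end LaurentSeries
end

noncomputable section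

/-! ### Consequences of the Jacobi identity, first for modes, then for residues against a series. -/

namespace VertexAlgebra

open HahnSeries LaurentSeries VertexOperator

theorem res_smul {V : Type*} [AddCommGroup V] [Module ℂ V] (f : LaurentSeries ℂ) (c : ℂ)
    (A : HahnModule ℤ ℂ V) : res f (c • A) = c • res f A := by
  have h : f • c • A = (C c : LaurentSeries ℂ) • f • A := by
    rw [smul_smul, mul_comm, mul_smul]
    exact congrArg (f • ·) (HahnModule.single_zero_smul_eq_smul ℤ).symm
  rw [res, h, C_apply, HahnModule.coeff_single_zero_smul, res]

theorem smul_res {V : Type*} [AddCommGroup V] [Module ℂ V] (f : LaurentSeries ℂ) (c : ℂ)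
    (A : HahnModule ℤ ℂ V) : res (c • f) A = c • res f A := by
  rw [res, ← C_mul_eq_smul, ← smul_smul, C_apply, HahnModule.coeff_single_zero_smul, res]

variable {V : Type*} [AddCommGroup V] [Module ℂ V] [VertexAlgebra V]

theorem exists_ncoeff_eq_zero (u v : V) : ∃ I : ℕ, ∀ n : ℤ, I ≤ n → ncoeff (Y u) n v = 0 :=
  ⟨(-((HahnModule.of ℂ).symm (Y u v)).order).toNat, fun n hn =>
    ncoeff_eq_zero_of_lt_order _ _ _ (by omega)⟩

theorem ncoeff_commutator (a u v : V) (m n : ℤ) {I : ℕ}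
    (hI : ∀ i : ℤ, I ≤ i → ncoeff (Y a) i u = 0) :
    ncoeff (Y a) m (ncoeff (Y u) n v) - ncoeff (Y u) n (ncoeff (Y a) m v) =
      ∑ i ∈ Finset.range I, Ring.choose m i • ncoeff (Y (ncoeff (Y a) i u)) (m + n - i) v := by
  -- At l = 0 each sum on the left reduces to its term i = 0.
  have h := jacobi a u v 0 m n
  rw [finsum_eq_single _ 0 fun i hi => by rw [Ring.choose_zero_pos _ (Nat.pos_of_ne_zero hi)]; simp,
    finsum_eq_single _ 0 fun i hi => by rw [Ring.choose_zero_pos _ (Nat.pos_of_ne_zero hi)]; simp,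
    finsum_eq_sum_of_support_subset (s := Finset.range I)] at h
  · simpa using h
  · intro i hi
    rw [Finset.coe_range, Set.mem_Iio]
    by_contra hlt
    refine hi ?_
    simp [hI i (by omega)]

theorem ncoeff_D (u v : V) (n : ℤ) : ncoeff (Y (D V u)) n v = -n • ncoeff (Y u) (n - 1) v := by
  -- Only the mode -1 of the vacuum survives: it occurs in the first sum for n < 0, in the second
  -- for n > 0, and nowhere for n = 0.
  have h := jacobi u vac v (-2) 0 n
  have hc : ∀ i : ℕ, ((-1) ^ i * Ring.choose (-2 : ℤ) i : ℤ) = i + 1 := by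
    intro i
    rw [Ring.choose_neg, show (2 + i - 1 : ℤ) = ((i + 1 : ℕ) : ℤ) by push_cast; ring,
      Ring.choose_natCast, Nat.choose_succ_self_right, Units.smul_def, smul_eq_mul, ← mul_assoc,
      Int.coe_negOnePow_natCast, ← mul_pow]
    simp
  have hr : ∑ᶠ i : ℕ, (Ring.choose (0 : ℤ) i : ℤ) •
      ncoeff (Y (ncoeff (Y u) (-2 + i) vac)) (0 + n - i) v = ncoeff (Y (D V u)) n v := by
    rw [finsum_eq_single _ 0 fun i hi => by
      rw [Ring.choose_zero_pos _ (Nat.pos_of_ne_zero hi)]; simp]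
    simp [D]
  rw [hr] at h
  rw [← h]
  simp only [vac_ncoeff, mul_assoc, hc]
  rcases lt_trichotomy n 0 with hn | rfl | hn
  · obtain ⟨k, rfl⟩ : ∃ k : ℕ, n = -(k + 1) := ⟨(-n - 1).toNat, by omega⟩
    rw [finsum_eq_single _ k fun i hi => by rw [if_neg (by omega)]; simp,
      finsum_eq_zero_of_forall_eq_zero fun i => by rw [if_neg (by omega)]; simp]
    rw [if_pos (by omega), sub_zero, show (0 + -2 - (k : ℤ)) = -(k + 1) - 1 by ring, neg_neg]
  · rw [finsum_eq_zero_of_forall_eq_zero fun i => by rw [if_neg (by omega)]; simp,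
      finsum_eq_zero_of_forall_eq_zero fun i => by rw [if_neg (by omega)]; simp]
    simp
  · obtain ⟨k, rfl⟩ : ∃ k : ℕ, n = k + 1 := ⟨(n - 1).toNat, by omega⟩
    rw [finsum_eq_zero_of_forall_eq_zero fun i => by rw [if_neg (by omega)]; simp,
      finsum_eq_single _ k fun i hi => by rw [if_neg (by omega)]; simp]
    rw [if_pos (by omega), show (0 + (k : ℤ)) = k + 1 - 1 by ring, zero_sub, neg_smul,
      Int.negOnePow_even _ (by decide), Units.val_one, one_mul]

/-- `𝒟` as a linear map. -/
def DLinear : V →ₗ[ℂ] V where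
  toFun := D V
  map_add' u v := by simp [D]
  map_smul' c u := by simp [D]

variable (V) in
/-- The image of `𝒟`. -/
def rangeD : Submodule ℂ V := LinearMap.range (DLinear (V := V))

theorem D_mem_rangeD (u : V) : D V u ∈ rangeD V := ⟨u, rfl⟩

/-- Replacing u by 𝒟u lowers the mode by one at the cost of the factor k + 2, which is invertible in
ℂ. -/
theorem ncoeff_vac_mem_rangeD (u : V) (k : ℕ) : ncoeff (Y u) (-(k + 2)) vac ∈ rangeD V := by
  induction k generalizing u with
  | zero => exact D_mem_rangeD u
  | succ k ih =>
    have h := ncoeff_D u vac (-(k + 2))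
    have hk : (k : ℂ) + 2 ≠ 0 := by exact_mod_cast (k + 1).succ_ne_zero
    have h2 : ncoeff (Y u) (-((k + 1 : ℕ) + 2)) vac =
        ((k : ℂ) + 2)⁻¹ • ncoeff (Y (D V u)) (-(k + 2)) vac := by
      rw [eq_inv_smul_iff₀ hk, h, neg_neg, ← Int.cast_smul_eq_zsmul ℂ]
      push_cast
      congr 3
    rw [h2]
    exact Submodule.smul_mem _ _ (ih _)

theorem ncoeff_skew (u v : V) (n : ℤ) :
    ncoeff (Y u) n v + (-1 : ℂ) ^ n • ncoeff (Y v) n u ∈ rangeD V := by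
  -- Applied to the vacuum, the first sum vanishes, the second leaves only i = 0, and the right side
  -- is `u_n v` plus terms in the image of 𝒟.
  have h := jacobi u v vac n (-1) 0
  obtain ⟨I, hI⟩ := exists_ncoeff_eq_zero u v
  rw [finsum_eq_zero_of_forall_eq_zero fun i => by
      rw [ncoeff_vac v _ (by omega), if_neg (by omega)]; simp,
    finsum_eq_single _ 0 fun i hi => by
      rw [ncoeff_vac u _ (by omega), if_neg (by omega)]; simp,
    -- Beyond this range n + i ≥ I; the extra 1 lets the term i = 0 be split off.
    finsum_eq_sum_of_support_subset (s := Finset.range ((I + n.natAbs) + 1)),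
    Finset.sum_range_succ'] at h
  · have hs : ((n.negOnePow : ℤ) : ℂ) = (-1) ^ n := Int.cast_negOnePow ℂ n
    simp only [Nat.cast_zero, pow_zero, mul_one, Ring.choose_zero_right, add_zero, sub_zero,
      one_smul, zero_add, zero_sub, ncoeff_vac _ _ le_rfl, if_true,
      ← Int.cast_smul_eq_zsmul ℂ (n.negOnePow : ℤ), hs] at h
    rw [← neg_mem_iff, neg_add, h, add_comm, add_neg_cancel_right]
    refine Submodule.sum_mem _ fun i _ => ?_
    rw [← Int.cast_smul_eq_zsmul ℂ]
    refine Submodule.smul_mem _ _ ?_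
    rw [show (-1 - ((i + 1 : ℕ) : ℤ)) = -(i + 2) by push_cast; ring]
    exact ncoeff_vac_mem_rangeD _ i
  · intro i hi
    rw [Finset.coe_range, Set.mem_Iio]
    by_contra hlt
    refine hi ?_
    simp [hI (n + i) (by omega)]

/-- `Res_x f(x) Y(u, x) v`, linear in `f`, `u` and `v`. -/
def mode : LaurentSeries ℂ →ₗ[ℂ] V →ₗ[ℂ] V →ₗ[ℂ] V where
  toFun f := LinearMap.mk₂ ℂ (fun u v => res f (Y u v))
    (fun u u' v => by simp [res])
    (fun c u v => by rw [map_smul, LinearMap.smul_apply, res_smul])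
    (fun u v v' => by simp [res])
    (fun c u v => by rw [map_smul, res_smul])
  map_add' f f' := by
    ext u v
    simp [res, add_smul]
  map_smul' c f := by
    ext u v
    exact smul_res f c (Y u v)

theorem mode_apply (f : LaurentSeries ℂ) (u v : V) : mode f u v = res f (Y u v) := rfl

theorem mode_single (n : ℤ) (c : ℂ) (u v : V) :
    mode (single n c) u v = c • ncoeff (Y u) n v := by
  rw [mode_apply, res, show (-1 : ℤ) = n +ᵥ (-n - 1) by rw [vadd_eq_add]; ring,
    HahnModule.coeff_single_smul_vadd]
  rfl

/-- `Res_x f(x) Y(u, x) v` as a linear map in `f`. -/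
def modeAt (u v : V) : LaurentSeries ℂ →ₗ[ℂ] V := (mode.flip u).flip v

@[simp]
theorem modeAt_apply (u v : V) (f : LaurentSeries ℂ) : modeAt u v f = mode f u v := rfl

theorem isDiscrete_modeAt (u v : V) : IsDiscrete (modeAt u v) := by
  refine ⟨-((HahnModule.of ℂ).symm (Y u v)).order, fun f hf => ?_⟩
  rw [modeAt_apply, mode_apply, res, HahnModule.coeff_smul]
  refine Finset.sum_eq_zero fun x hx => ?_
  rw [Finset.mem_vaddAntidiagonal, vadd_eq_add] at hx
  rcases lt_or_ge x.1 (-((HahnModule.of ℂ).symm (Y u v)).order) with h | h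
  · rw [hf _ h, zero_smul]
  · rw [HahnSeries.coeff_eq_zero_of_lt_order (x := (HahnModule.of ℂ).symm (Y u v)) (by omega),
      smul_zero]

theorem mode_mem {W : Submodule ℂ V} {u v : V} (h : ∀ n, ncoeff (Y u) n v ∈ W)
    (f : LaurentSeries ℂ) : mode f u v ∈ W :=
  (isDiscrete_modeAt u v).mem W (fun i => by
    rw [modeAt_apply, mode_single, one_smul]
    exact h i) f

/-- Integration by parts: Y(𝒟u, x) is the derivative of Y(u, x). -/
theorem mode_D (f : LaurentSeries ℂ) (u v : V) :
    mode f (D V u) v = -mode (LaurentSeries.derivative ℂ f) u v := by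
  refine (isDiscrete_modeAt (D V u) v).eq (ψ := -(modeAt u v ∘ₗ LaurentSeries.derivative ℂ))
    ((isDiscrete_modeAt u v).comp_hasseDeriv 1).neg (fun i => ?_) f
  rw [LinearMap.neg_apply, LinearMap.comp_apply, modeAt_apply, modeAt_apply, derivative_single,
    mode_single, mode_single, ncoeff_D, one_smul, neg_smul, Int.cast_smul_eq_zsmul]

theorem mode_skew (f : LaurentSeries ℂ) (u v : V) :
    mode f u v + mode (negVar f) v u ∈ rangeD V := by
  refine ((isDiscrete_modeAt u v).add (isDiscrete_modeAt v u).comp_negVar).mem _ (fun i => ?_) f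
  rw [LinearMap.add_apply, LinearMap.comp_apply, modeAt_apply, modeAt_apply, negVar_single,
    mode_single, mode_single, one_smul]
  exact ncoeff_skew u v i

theorem ncoeff_mode_commutator (m : ℤ) (g : LaurentSeries ℂ) (a u v : V) {I : ℕ}
    (hI : ∀ i : ℤ, I ≤ i → ncoeff (Y a) i u = 0) :
    ncoeff (Y a) m (mode g u v) - mode g u (ncoeff (Y a) m v) =
      ∑ i ∈ Finset.range I,
        mode (hasseDeriv ℂ i (single m (1 : ℂ)) * g) (ncoeff (Y a) i u) v := by
  have h := (((isDiscrete_modeAt u v).comp (ncoeff (Y a) m)).sub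
    (isDiscrete_modeAt u (ncoeff (Y a) m v))).eq
    (IsDiscrete.sum (Finset.range I) (fun i : ℕ => modeAt (ncoeff (Y a) i u) v ∘ₗ
      mulBy (hasseDeriv ℂ i (single m (1 : ℂ)))) fun i _ =>
        (isDiscrete_modeAt _ _).comp_mulBy _) (fun n => ?_) g
  · simpa only [LinearMap.sub_apply, LinearMap.sum_apply, LinearMap.comp_apply, modeAt_apply,
      mulBy_apply, mul_comm g] using h
  · simp only [LinearMap.sub_apply, LinearMap.sum_apply, LinearMap.comp_apply, modeAt_apply,
      mulBy_apply, mode_single, one_smul, hasseDeriv_single, single_mul_single, one_mul]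
    rw [ncoeff_commutator a u v m n hI]
    refine Finset.sum_congr rfl fun i _ => ?_
    rw [zsmul_one, Int.cast_smul_eq_zsmul, show n + (m - i) = m + n - i by ring]

/-- The Hasse derivatives come from Taylor expanding f(x₁) around x₂. The formula is extended from
monomials one variable at a time. -/
theorem mode_commutator (f g : LaurentSeries ℂ) (a u v : V) {I : ℕ}
    (hI : ∀ i : ℤ, I ≤ i → ncoeff (Y a) i u = 0) :
    mode f a (mode g u v) - mode g u (mode f a v) =
      ∑ i ∈ Finset.range I, mode (hasseDeriv ℂ i f * g) (ncoeff (Y a) i u) v := by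
  have h := ((isDiscrete_modeAt a (mode g u v)).sub
    ((isDiscrete_modeAt a v).comp (mode g u))).eq
    (IsDiscrete.sum (Finset.range I) (fun i : ℕ => (modeAt (ncoeff (Y a) i u) v ∘ₗ
      mulBy g) ∘ₗ hasseDeriv ℂ i) fun i _ =>
        ((isDiscrete_modeAt _ _).comp_mulBy _).comp_hasseDeriv i) (fun m => ?_) f
  · simpa only [LinearMap.sub_apply, LinearMap.sum_apply, LinearMap.comp_apply, modeAt_apply,
      mulBy_apply] using h
  · simp only [LinearMap.sub_apply, LinearMap.sum_apply, LinearMap.comp_apply, modeAt_apply,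
      mulBy_apply, mode_single, one_smul]
    exact ncoeff_mode_commutator m g a u v hI

end VertexAlgebra
end

noncomputable section

namespace VertexAlgebra

/-! ### The polynomial p with K = p(t), and its symmetry. -/

section KernelPoly

open Polynomial

/-- The polynomial `∑_{m ≤ N} (-1)^m C(m+N,N) X^m (1+X)^(N+1)`, whose value at
`t = 1 / (e^x - 1)` is the kernel of the product `•`. -/
def kernelPoly (N : ℕ) : ℂ[X] :=
  ∑ m ∈ Finset.range (N + 1), C ((-1) ^ m * ((m + N).choose N : ℂ)) * X ^ m * (1 + X) ^ (N + 1)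

theorem one_add_X_pow_dvd_kernelPoly (N : ℕ) : (1 + X : ℂ[X]) ^ (N + 1) ∣ kernelPoly N :=
  Finset.dvd_sum fun _ _ => Dvd.intro_left _ rfl

theorem derivative_kernelPoly (N : ℕ) :
    ∃ c : ℂ, derivative (kernelPoly N) = C c * (X ^ N * (1 + X) ^ N) := by
  -- The truncation point M varies while N stays fixed, so that the sum telescopes: each new summand
  -- cancels the previous remainder and leaves one in X^(M+1).
  have h : ∀ M : ℕ, derivative (∑ m ∈ Finset.range (M + 1),
      C ((-1) ^ m * ((m + N).choose N : ℂ)) * X ^ m * (1 + X) ^ (N + 1)) =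
      C ((-1) ^ M * ((M + N).choose N : ℂ) * (M + N + 1)) * (X ^ M * (1 + X) ^ N) := by
    intro M
    induction M with
    | zero =>
      simp [derivative_pow_succ]
    | succ M ih =>
      have hc : ((M + 1 + N).choose N : ℂ) * (M + 1) = ((M + N).choose N : ℂ) * (M + N + 1) := by
        have h1 := Nat.add_one_mul_choose_eq (M + N) M
        have h2 : (M + N).choose M = (M + N).choose N := Nat.choose_symm_add
        have h3 : (M + N + 1).choose (M + 1) = (M + 1 + N).choose N := by
          rw [show M + N + 1 = M + 1 + N by ring]
          exact Nat.choose_symm_add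
        rw [h2, h3] at h1
        have h4 : ((M + N + 1 : ℕ) : ℂ) * ((M + N).choose N : ℂ) =
          ((M + 1 + N).choose N : ℂ) * ((M + 1 : ℕ) : ℂ) := by exact_mod_cast h1
        push_cast at h4
        linear_combination -h4
      have hc' := congrArg (C : ℂ → ℂ[X]) hc
      rw [Finset.sum_range_succ, map_add, ih]
      simp only [derivative_mul, derivative_C, derivative_pow, derivative_X, derivative_add,
        derivative_one, Nat.add_sub_cancel]
      push_cast
      simp only [map_mul, map_add, map_pow, map_neg, map_one, map_natCast] at hc' ⊢
      linear_combination (-1) ^ (M + 1) * X ^ M * (1 + X) ^ N * hc'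
  exact ⟨_, h N⟩

theorem eval_zero_kernelPoly (N : ℕ) : (kernelPoly N).eval 0 = 1 := by
  rw [kernelPoly, eval_finsetSum, Finset.sum_range_succ']
  simp

theorem eval_neg_one_kernelPoly (N : ℕ) : (kernelPoly N).eval (-1) = 0 := by
  simp [kernelPoly, eval_finsetSum]

/-- The derivative, a multiple of X^N (1+X)^N, is invariant under the reflection, so the sum of p
and its reflection is constant, equal to p(0) + p(-1) = 1. -/
theorem kernelPoly_comp (N : ℕ) : (kernelPoly N).comp (-1 - X) = 1 - kernelPoly N := by
  obtain ⟨c, hc⟩ := derivative_kernelPoly N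
  have h0 : derivative (kernelPoly N + (kernelPoly N).comp (-1 - X)) = 0 := by
    rw [derivative_add, derivative_comp, hc]
    simp only [mul_comp, C_comp, pow_comp, X_comp, add_comp, one_comp, derivative_sub,
      derivative_neg, derivative_one, derivative_X]
    rw [show (1 + (-1 - X) : ℂ[X]) = -X by ring, show (-1 - X : ℂ[X]) = -(1 + X) by ring,
      neg_pow (1 + X : ℂ[X]), neg_pow (X : ℂ[X])]
    have : ((-1 : ℂ[X]) ^ N) * (-1) ^ N = 1 := by rw [← mul_pow]; simp
    linear_combination (-C c * X ^ N * (1 + X) ^ N) * this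
  have h1 := eq_C_of_derivative_eq_zero h0
  have h2 := congrArg (eval 0) h1
  rw [eval_add, eval_comp, eval_C] at h2
  simp only [eval_sub, eval_neg, eval_one, eval_X, sub_zero, eval_zero_kernelPoly,
    eval_neg_one_kernelPoly, add_zero] at h2
  rw [← h2, C_1] at h1
  linear_combination h1

/-- The reflection carries the zero of p at -1 to a zero of p - 1 at 0 of the same order at least N
+ 1. -/
theorem dvd_kernelPoly_mul (N : ℕ) :
    ((1 + X) ^ (N + 1) * X ^ (N + 1) : ℂ[X]) ∣ kernelPoly N * (kernelPoly N - 1) := by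
  refine mul_dvd_mul (one_add_X_pow_dvd_kernelPoly N) ?_
  obtain ⟨q, hq⟩ := one_add_X_pow_dvd_kernelPoly N
  have h := kernelPoly_comp N
  rw [hq, mul_comp, ← hq] at h
  simp only [pow_comp, add_comp, one_comp, X_comp] at h
  rw [show (1 + (-1 - X) : ℂ[X]) = -X by ring, neg_pow] at h
  exact ⟨-((-1) ^ (N + 1) * q.comp (-1 - X)), by linear_combination h⟩

end KernelPoly

/-! ### Kernels as Laurent series, and the spaces generated by the kernels of `◇`. -/

section Kernel

open HahnSeries LaurentSeries

local notation "τ" => invExpSubOne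

/-- The Laurent series with `u • v = Res_x kernel(x) Y(u,x) v`. -/
def kernel (N : ℕ) : LaurentSeries ℂ := evalInv (kernelPoly N)

theorem kernel_eq (N : ℕ) : kernel N = ∑ m ∈ Finset.range (N + 1),
    ((-1) ^ m * ((m + N).choose N : ℂ)) • expQuot (N + 1) (N + m + 1) := by
  rw [kernel, kernelPoly, map_sum]
  refine Finset.sum_congr rfl fun m _ => ?_
  have h := expQuot_natCast (N + 1) m
  rw [show N + 1 + m = N + m + 1 by ring] at h
  push_cast at h
  rw [h, ← C_mul_eq_smul, map_mul, map_mul, evalInv_C, map_pow, map_pow, evalInv_X, map_add,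
    map_one, evalInv_X]
  ring

theorem negVar_kernel (N : ℕ) : negVar (kernel N) = 1 - kernel N := by
  rw [kernel, negVar_evalInv, kernelPoly_comp, map_sub, map_one]

theorem coeff_neg_one_kernel (N : ℕ) : (kernel N).coeff (-1) = 1 := by
  rw [kernel, coeff_neg_one_evalInv, eval_zero_kernelPoly, eval_neg_one_kernelPoly, sub_zero]

/-- The series `e^(ax) t^k p(t)` with `t = 1 / (e^x - 1)` and `p` a polynomial. -/
def expSpan (a : ℂ) (k : ℕ) : Submodule ℂ (LaurentSeries ℂ) where
  carrier := {f | ∃ p, f = expSeries a * τ ^ k * evalInv p}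
  add_mem' := by
    rintro _ _ ⟨p, rfl⟩ ⟨q, rfl⟩
    exact ⟨p + q, by rw [map_add]; ring⟩
  zero_mem' := ⟨0, by simp⟩
  smul_mem' := by
    rintro c _ ⟨p, rfl⟩
    exact ⟨Polynomial.C c * p, by rw [map_mul, evalInv_C, ← C_mul_eq_smul]; ring⟩

theorem evalInv_mem_expSpan (p : Polynomial ℂ) : evalInv p ∈ expSpan 0 0 :=
  ⟨p, by rw [expSeries_zero]; ring⟩

theorem one_mem_expSpan : (1 : LaurentSeries ℂ) ∈ expSpan 0 0 := by
  have h := evalInv_mem_expSpan 1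
  rwa [map_one] at h

theorem kernel_mem_expSpan (N : ℕ) : kernel N ∈ expSpan 0 0 := evalInv_mem_expSpan _

theorem mul_mem_expSpan {a : ℂ} {k : ℕ} {f h : LaurentSeries ℂ} (hf : f ∈ expSpan 0 0)
    (hh : h ∈ expSpan a k) : f * h ∈ expSpan a k := by
  obtain ⟨p, rfl⟩ := hf
  obtain ⟨q, rfl⟩ := hh
  exact ⟨p * q, by rw [map_mul, expSeries_zero]; ring⟩

theorem derivative_mem_expSpan {a : ℂ} {k : ℕ} {f : LaurentSeries ℂ} (hf : f ∈ expSpan a k) :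
    derivative ℂ f ∈ expSpan a k := by
  obtain ⟨p, rfl⟩ := hf
  rw [derivative_mul, derivative_expSeries_mul_pow, derivative_evalInv]
  refine ⟨(Polynomial.C (a - k) - Polynomial.C (k : ℂ) * Polynomial.X) * p +
    -(Polynomial.X + Polynomial.X ^ 2) * Polynomial.derivative p, ?_⟩
  simp only [map_add, map_mul, map_sub, evalInv_C, evalInv_X]
  ring

theorem hasseDeriv_mem_expSpan {a : ℂ} {k : ℕ} {f : LaurentSeries ℂ} (hf : f ∈ expSpan a k)
    (i : ℕ) : hasseDeriv ℂ i f ∈ expSpan a k := by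
  have h : ∀ j : ℕ, (derivative ℂ)^[j] f ∈ expSpan a k := by
    intro j
    induction j with
    | zero => exact hf
    | succ j ih =>
      rw [Function.iterate_succ_apply']
      exact derivative_mem_expSpan ih
  have hi : (i.factorial : ℂ) ≠ 0 := by exact_mod_cast i.factorial_ne_zero
  have h2 := h i
  rw [derivative_iterate, ← Nat.cast_smul_eq_nsmul ℂ] at h2
  exact (Submodule.smul_mem_iff _ hi).mp h2

/-- Only f' is assumed to lie in the space; this is what is known about K. -/
theorem hasseDeriv_succ_mem_expSpan {a : ℂ} {k : ℕ} {f : LaurentSeries ℂ}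
    (hf : derivative ℂ f ∈ expSpan a k) (i : ℕ) : hasseDeriv ℂ (i + 1) f ∈ expSpan a k := by
  have hi : ((i + 1 : ℕ) : ℂ) ≠ 0 := by exact_mod_cast i.succ_ne_zero
  have h := hasseDeriv_mem_expSpan hf i
  rw [derivative_apply, hasseDeriv_comp, Nat.choose_symm_add, Nat.choose_one_right,
    ← Nat.cast_smul_eq_nsmul ℂ] at h
  exact (Submodule.smul_mem_iff _ hi).mp h

/-- (1+t)^(N+1) t^(N+1) = e^((N+1)x) t^(2N+2), the kernel of `◇` on V^0 with N = ⌊n⌋. -/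
theorem evalInv_mem_expSpan_of_dvd {N : ℕ} {p : Polynomial ℂ}
    (h : (1 + Polynomial.X) ^ (N + 1) * Polynomial.X ^ (N + 1) ∣ p) :
    evalInv p ∈ expSpan (N + 1) (2 * N + 2) := by
  obtain ⟨q, rfl⟩ := h
  refine ⟨q, ?_⟩
  have h := expQuot_natCast (N + 1) (N + 1)
  rw [expQuot_eq, show N + 1 + (N + 1) = 2 * N + 2 by ring] at h
  push_cast at h
  rw [h, map_mul, map_mul, map_pow, map_pow, map_add, map_one, evalInv_X]

theorem derivative_kernel_mem (N : ℕ) :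
    derivative ℂ (kernel N) ∈ expSpan (N + 1) (2 * N + 2) := by
  obtain ⟨c, hc⟩ := derivative_kernelPoly N
  rw [kernel, derivative_evalInv, hc]
  exact evalInv_mem_expSpan_of_dvd ⟨-Polynomial.C c, by ring⟩

theorem kernel_mul_mem (N : ℕ) : kernel N * (kernel N - 1) ∈ expSpan (N + 1) (2 * N + 2) := by
  rw [kernel, ← map_one evalInv, ← map_sub, ← map_mul]
  exact evalInv_mem_expSpan_of_dvd (dvd_kernelPoly_mul N)

end Kernel

end VertexAlgebra
end

noncomputable section

/-! ### The vacuum and 𝒟 under residues. -/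

namespace VertexAlgebra

open HahnSeries LaurentSeries VertexOperator

section

variable {V : Type*} [AddCommGroup V] [Module ℂ V] {g : V ≃ₗ[ℂ] V} {T : ℕ}

theorem rootOfUnity_zero (T : ℕ) : rootOfUnity T 0 = 1 := by simp [rootOfUnity]

theorem mem_gradedPiece {r : ℕ} {u : V} : u ∈ gradedPiece g T r ↔ g u = rootOfUnity T r • u :=
  Module.End.mem_eigenspace_iff

theorem mem_gradedPiece_zero {u : V} : u ∈ gradedPiece g T 0 ↔ g u = u := by
  rw [mem_gradedPiece, rootOfUnity_zero, one_smul]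

end

section

variable {V : Type*} [AddCommGroup V] [Module ℂ V] [VertexAlgebra V]

theorem mode_vac_left (f : LaurentSeries ℂ) (v : V) : mode f vac v = f.coeff (-1) • v := by
  refine (isDiscrete_modeAt vac v).eq (ψ := (LinearMap.toSpanSingleton ℂ V v) ∘ₗ coeffLinear (-1))
    ((isDiscrete_coeffLinear (-1)).comp _) (fun i => ?_) f
  rw [modeAt_apply, mode_single, one_smul, vac_ncoeff, LinearMap.comp_apply,
    LinearMap.toSpanSingleton_apply]
  change _ = (single i (1 : ℂ)).coeff (-1) • v
  rw [coeff_single]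
  by_cases h : i = -1
  · simp [h]
  · simp [h, Ne.symm h]

theorem mode_vac_right (f : LaurentSeries ℂ) (u : V) :
    mode f u vac - f.coeff (-1) • u ∈ rangeD V := by
  have h := mode_skew f u vac
  rw [mode_vac_left, coeff_negVar] at h
  simpa [sub_eq_add_neg] using h

/-- Modulo `𝒟 V`, the operator `Res_x f(x) Y(a, x)` takes `𝒟 u` to `Res_x f'(x) Y(a, x) u`. -/
theorem mode_apply_D (f : LaurentSeries ℂ) (a u : V) :
    mode f a (D V u) - mode (LaurentSeries.derivative ℂ f) a u ∈ rangeD V := by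
  have h1 := mode_skew f a (D V u)
  have h2 := mode_skew (LaurentSeries.derivative ℂ f) a u
  have h3 : negVar (LaurentSeries.derivative ℂ f) =
      -LaurentSeries.derivative ℂ (negVar f) := by
    ext n
    rw [coeff_negVar, coeff_neg, derivative_apply, derivative_apply, hasseDeriv_coeff,
      hasseDeriv_coeff, coeff_negVar, zpow_add₀ (by norm_num)]
    simp
    ring
  rw [mode_D] at h1
  rw [h3, map_neg, LinearMap.neg_apply, LinearMap.neg_apply] at h2
  convert Submodule.sub_mem _ h1 h2 using 1
  abel

theorem mode_one (a v : V) : mode 1 a v = ncoeff (Y a) 0 v := by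
  rw [← single_zero_one, mode_single, one_smul]

/-- The zero mode of a is a derivation, because the constant 1 has no higher Hasse derivatives. -/
theorem mode_one_mode (f : LaurentSeries ℂ) (a u v : V) :
    mode 1 a (mode f u v) = mode f (mode 1 a u) v + mode f u (mode 1 a v) := by
  obtain ⟨I, hI⟩ := exists_ncoeff_eq_zero a u
  have h := mode_commutator 1 f a u v (I := I + 1) fun i hi => hI i (by omega)
  rw [Finset.sum_range_succ', Finset.sum_eq_zero fun i _ => by
    rw [← single_zero_one, hasseDeriv_single, Ring.choose_zero_succ]; simp] at h
  rw [hasseDeriv_zero, LinearMap.id_apply, one_mul, zero_add, Nat.cast_zero, ← mode_one] at h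
  rw [← h]
  abel

theorem bulletHom_eq (n : ℚ) (u v : V) : bulletHom n u v = mode (kernel ⌊n⌋₊) u v := by
  rw [kernel_eq, map_sum, LinearMap.sum_apply, LinearMap.sum_apply, bulletHom]
  refine Finset.sum_congr rfl fun m _ => ?_
  rw [map_smul, LinearMap.smul_apply, LinearMap.smul_apply, mode_apply]

end

/-! ### The subspace Õ and its stability. -/

section

variable {V : Type*} [AddCommGroup V] [Module ℂ V] [VertexAlgebra V] {g : V ≃ₗ[ℂ] V} {T : ℕ}
  {n : ℚ}

theorem vac_mem_gradedPiece (hg : IsAutomorphism g) : (vac : V) ∈ gradedPiece g T 0 :=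
  mem_gradedPiece_zero.mpr hg.map_vac

theorem ncoeff_mem_gradedPiece (hg : IsAutomorphism g) {r : ℕ} {a v : V}
    (ha : a ∈ gradedPiece g T 0) (hv : v ∈ gradedPiece g T r) (i : ℤ) :
    ncoeff (Y a) i v ∈ gradedPiece g T r := by
  rw [mem_gradedPiece_zero] at ha
  rw [mem_gradedPiece] at hv ⊢
  rw [hg.map_ncoeff, ha, hv, map_smul]

theorem D_mem_gradedPiece (hg : IsAutomorphism g) {r : ℕ} {u : V} (hu : u ∈ gradedPiece g T r) :
    D V u ∈ gradedPiece g T r := by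
  rw [mem_gradedPiece] at hu ⊢
  rw [D, hg.map_ncoeff, hg.map_vac, hu]
  simp

theorem mode_mem_gradedPiece (hg : IsAutomorphism g) {r : ℕ} {a v : V}
    (ha : a ∈ gradedPiece g T 0) (hv : v ∈ gradedPiece g T r) (f : LaurentSeries ℂ) :
    mode f a v ∈ gradedPiece g T r :=
  mode_mem (fun i => ncoeff_mem_gradedPiece hg ha hv i) f

theorem rangeD_le_OTilde : rangeD V ≤ OTilde g T n := by
  rintro _ ⟨u, rfl⟩
  exact Submodule.subset_span (Or.inr ⟨u, rfl⟩)

/-- The exponent of `e^x` in the definition of `◇` on `V^r`. -/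
def diamondExp (T : ℕ) (n : ℚ) (r : ℕ) : ℂ := delta (nbar T n) r + ⌊n⌋₊ + r / T

/-- The exponent of `e^x - 1` in the definition of `◇` on `V^r`. -/
def diamondPole (T : ℕ) (n : ℚ) (r : ℕ) : ℕ :=
  2 * ⌊n⌋₊ + delta (nbar T n) r + delta (nbar T n) (T - r) + 1

theorem diamondHom_eq (r : ℕ) (u v : V) : diamondHom T n r u v =
    mode (expSeries (diamondExp T n r) * invExpSubOne ^ diamondPole T n r) u v := by
  rw [mode_apply, ← expQuot_eq]
  rfl

theorem diamondHom_mem_OTilde {r : ℕ} (hr : r < T) {u : V} (hu : u ∈ gradedPiece g T r) (v : V) :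
    diamondHom T n r u v ∈ OTilde g T n :=
  Submodule.subset_span (Or.inl ⟨u, v, (diamond_of_mem g hr n hu v).symm⟩)

/-- Using 𝒟u in place of u differentiates the kernel. The derivative of e^(ax) t^k combines that
kernel with -k e^(ax) t^(k+1), and k ≠ 0, so the pole order can be raised by one. -/
theorem mode_expSeries_mul_pow_mem (hg : IsAutomorphism g) {r : ℕ} (hr : r < T) (v : V) (j : ℕ)
    {u : V} (hu : u ∈ gradedPiece g T r) :
    mode (expSeries (diamondExp T n r) * invExpSubOne ^ (diamondPole T n r + j)) u v ∈
      OTilde g T n := by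
  induction j generalizing u with
  | zero =>
    rw [add_zero, ← diamondHom_eq]
    exact diamondHom_mem_OTilde hr hu v
  | succ j ih =>
    have h := ih (D_mem_gradedPiece hg hu)
    rw [mode_D, neg_mem_iff, derivative_expSeries_mul_pow, C_mul_eq_smul, C_mul_eq_smul, map_sub,
      map_smul, map_smul] at h
    have h2 := Submodule.sub_mem _ (Submodule.smul_mem _
      (diamondExp T n r - ((diamondPole T n r + j : ℕ) : ℂ)) (ih hu)) h
    simp only [LinearMap.sub_apply, LinearMap.smul_apply, sub_sub_cancel] at h2
    refine (Submodule.smul_mem_iff _ ?_).mp h2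
    have : diamondPole T n r + j ≠ 0 := by rw [diamondPole]; omega
    exact_mod_cast this

theorem mode_mem_OTilde (hg : IsAutomorphism g) {r : ℕ} (hr : r < T) {u : V}
    (hu : u ∈ gradedPiece g T r) (v : V) {f : LaurentSeries ℂ}
    (hf : f ∈ expSpan (diamondExp T n r) (diamondPole T n r)) : mode f u v ∈ OTilde g T n := by
  obtain ⟨p, rfl⟩ := hf
  induction p using Polynomial.induction_on' with
  | add p q hp hq =>
    rw [map_add, mul_add, map_add]
    exact Submodule.add_mem _ hp hq
  | monomial k c =>
    rw [evalInv_monomial, mul_left_comm, C_mul_eq_smul, mul_assoc, ← _root_.pow_add, map_smul]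
    exact Submodule.smul_mem _ _ (mode_expSeries_mul_pow_mem hg hr v k hu)

theorem mode_mem_OTilde_of_zero (hg : IsAutomorphism g) (hT : 0 < T) (hn : ∃ k : ℕ, n = k / T)
    {u : V} (hu : u ∈ gradedPiece g T 0) (v : V) {f : LaurentSeries ℂ}
    (hf : f ∈ expSpan (⌊n⌋₊ + 1) (2 * ⌊n⌋₊ + 2)) : mode f u v ∈ OTilde g T n := by
  refine mode_mem_OTilde hg hT hu v ?_
  have h1 : delta (nbar T n) 0 = 1 := if_pos (Nat.zero_le _)
  have h2 : delta (nbar T n) (T - 0) = 0 := if_neg (by have := (nbar_spec hT hn).1; omega)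
  have h3 : diamondExp T n 0 = ⌊n⌋₊ + 1 := by
    rw [diamondExp, h1]
    push_cast
    ring
  have h4 : diamondPole T n 0 = 2 * ⌊n⌋₊ + 2 := by rw [diamondPole, h1, h2]
  rwa [h3, h4]

theorem diamondExp_ne_intCast {r : ℕ} (hr0 : 0 < r) (hr : r < T) (j : ℤ) :
    diamondExp T n r ≠ j := by
  intro h
  have hT : (T : ℂ) ≠ 0 := by exact_mod_cast (by omega : T ≠ 0)
  rw [diamondExp] at h
  have h2 : (r : ℂ) = T * (j - delta (nbar T n) r - ⌊n⌋₊) := by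
    rw [← h]
    field_simp
    ring
  have h3 : (r : ℤ) = T * (j - delta (nbar T n) r - ⌊n⌋₊) := by exact_mod_cast h2
  have h4 := Int.eq_zero_of_dvd_of_nonneg_of_lt (by omega) (by omega : (r : ℤ) < T) ⟨_, h3⟩
  omega

/-- Modulo 𝒟V, u ◇ 1 is u times the residue of the kernel, which is nonzero because r/T is not an
integer. -/
theorem gradedPiece_le_OTilde {r : ℕ} (hr0 : 0 < r) (hr : r < T) :
    gradedPiece g T r ≤ OTilde g T n := by
  intro u hu
  have h1 := diamondHom_mem_OTilde (n := n) hr hu vac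
  rw [diamondHom_eq] at h1
  have h2 := rangeD_le_OTilde (g := g) (T := T) (n := n) (mode_vac_right
    (expSeries (diamondExp T n r) * invExpSubOne ^ diamondPole T n r) u)
  have h3 := Submodule.sub_mem _ h1 h2
  rw [sub_sub_cancel] at h3
  exact (Submodule.smul_mem_iff _
    (coeff_neg_one_expSeries_mul_pow_ne_zero (diamondExp_ne_intCast hr0 hr) _)).mp h3

theorem sub_proj_mem_OTilde (hT : 0 < T) (hgT : g ^ T = 1) (u : V) :
    u - proj g T 0 u ∈ OTilde g T n := by
  obtain ⟨S, rfl⟩ : ∃ S, T = S + 1 := ⟨T - 1, by omega⟩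
  have h := sum_proj g hT u
  rw [Finset.sum_range_succ'] at h
  nth_rw 1 [← h]
  rw [add_sub_cancel_right]
  refine Submodule.sum_mem _ fun r hr => ?_
  exact gradedPiece_le_OTilde (Nat.succ_pos r) (by rw [Finset.mem_range] at hr; omega)
    (proj_mem g hgT _ u)

theorem mode_zero_D_mem (a u : V) : mode 1 a (D V u) ∈ OTilde g T n := by
  have h := mode_apply_D 1 a u
  rw [derivative_one, map_zero, LinearMap.zero_apply, LinearMap.zero_apply, sub_zero] at h
  exact rangeD_le_OTilde h

/-- An operator preserves `Õ` if it preserves the generators `𝒟 u` and `u ◇ v`, `u ∈ V^r`. -/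
theorem map_mem_OTilde (hgT : g ^ T = 1) (L : V →ₗ[ℂ] V)
    (hD : ∀ u, L (D V u) ∈ OTilde g T n)
    (hdiamond : ∀ r < T, ∀ u ∈ gradedPiece g T r, ∀ v, L (diamondHom T n r u v) ∈ OTilde g T n)
    {x : V} (hx : x ∈ OTilde g T n) : L x ∈ OTilde g T n := by
  have : OTilde g T n ≤ (OTilde g T n).comap L := by
    refine Submodule.span_le.mpr ?_
    rintro _ (⟨u, v, rfl⟩ | ⟨u, rfl⟩)
    · rw [SetLike.mem_coe, Submodule.mem_comap, diamond, map_sum]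
      exact Submodule.sum_mem _ fun r hr =>
        hdiamond r (Finset.mem_range.mp hr) _ (proj_mem g hgT r u) v
    · exact hD u
  exact this hx

theorem mode_one_mem_OTilde (hg : IsAutomorphism g) (hgT : g ^ T = 1) {a : V}
    (ha : a ∈ gradedPiece g T 0) {x : V} (hx : x ∈ OTilde g T n) : mode 1 a x ∈ OTilde g T n := by
  refine map_mem_OTilde hgT (mode 1 a) (mode_zero_D_mem a) (fun r hr u hu v => ?_) hx
  rw [diamondHom_eq, mode_one_mode, ← diamondHom_eq, ← diamondHom_eq]
  exact Submodule.add_mem _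
    (diamondHom_mem_OTilde hr (mode_mem_gradedPiece hg ha hu 1) v)
    (diamondHom_mem_OTilde hr hu _)

theorem mode_kernel_mem_OTilde (hg : IsAutomorphism g) (hT : 0 < T) (hgT : g ^ T = 1)
    (hn : ∃ k : ℕ, n = k / T) {a : V} (ha : a ∈ gradedPiece g T 0) {x : V}
    (hx : x ∈ OTilde g T n) : mode (kernel ⌊n⌋₊) a x ∈ OTilde g T n := by
  refine map_mem_OTilde hgT (mode (kernel ⌊n⌋₊) a) (fun u => ?_) (fun r hr u hu v => ?_) hx
  · have h := rangeD_le_OTilde (g := g) (T := T) (n := n) (mode_apply_D (kernel ⌊n⌋₊) a u)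
    exact (Submodule.sub_mem_iff_left _
      (mode_mem_OTilde_of_zero hg hT hn ha u (derivative_kernel_mem _))).mp h
  · obtain ⟨I, hI⟩ := exists_ncoeff_eq_zero a u
    -- Moving a past u leaves u ◇ (a • v) and commutator terms, whose kernels are polynomials in t
    -- times the kernel of `◇` on the same V^r.
    rw [diamondHom_eq, ← sub_add_cancel (mode (kernel ⌊n⌋₊) a _) (mode
      (expSeries (diamondExp T n r) * invExpSubOne ^ diamondPole T n r) u
      (mode (kernel ⌊n⌋₊) a v)), mode_commutator _ _ _ _ _ hI, ← diamondHom_eq]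
    refine Submodule.add_mem _ (Submodule.sum_mem _ fun i _ => ?_) (diamondHom_mem_OTilde hr hu _)
    refine mode_mem_OTilde hg hr (ncoeff_mem_gradedPiece hg ha hu i) v ?_
    exact mul_mem_expSpan (hasseDeriv_mem_expSpan (kernel_mem_expSpan _) i)
      ⟨1, by rw [map_one, mul_one]⟩

/-- `u • v ≡ v • u - v₀ u` modulo `𝒟 V`. -/
theorem mode_kernel_skew (N : ℕ) (u v : V) :
    mode (kernel N) u v - (mode (kernel N) v u - mode 1 v u) ∈ rangeD V := by
  have h := mode_skew (kernel N) u v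
  rw [negVar_kernel, map_sub, LinearMap.sub_apply, LinearMap.sub_apply] at h
  convert h using 1
  abel

theorem mode_kernel_mem_OTilde_of_left_mem (hg : IsAutomorphism g) (hT : 0 < T) (hgT : g ^ T = 1)
    (hn : ∃ k : ℕ, n = k / T) {a : V} (ha : a ∈ gradedPiece g T 0) {x : V}
    (hx : x ∈ OTilde g T n) : mode (kernel ⌊n⌋₊) x a ∈ OTilde g T n :=
  (Submodule.sub_mem_iff_left _ (Submodule.sub_mem _ (mode_kernel_mem_OTilde hg hT hgT hn ha hx)
    (mode_one_mem_OTilde hg hgT ha hx))).mp (rangeD_le_OTilde (mode_kernel_skew ⌊n⌋₊ x a))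

/-- The term i = 0 has kernel K(K-1); for i > 0 the factor K^(i) already lies in the space
containing K'. -/
theorem mode_kernel_commutator_mem (hg : IsAutomorphism g) (hT : 0 < T)
    (hn : ∃ k : ℕ, n = k / T) {a c : V} (ha : a ∈ gradedPiece g T 0)
    (hc : c ∈ gradedPiece g T 0) (v : V) :
    mode (kernel ⌊n⌋₊) a (mode (kernel ⌊n⌋₊ - 1) c v) -
      mode (kernel ⌊n⌋₊ - 1) c (mode (kernel ⌊n⌋₊) a v) ∈ OTilde g T n := by
  obtain ⟨I, hI⟩ := exists_ncoeff_eq_zero a c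
  rw [mode_commutator _ _ _ _ _ hI]
  refine Submodule.sum_mem _ fun i _ => ?_
  refine mode_mem_OTilde_of_zero hg hT hn (ncoeff_mem_gradedPiece hg ha hc i) v ?_
  cases i with
  | zero =>
    rw [hasseDeriv_zero, LinearMap.id_apply]
    exact kernel_mul_mem _
  | succ i =>
    rw [mul_comm (hasseDeriv ℂ (i + 1) (kernel ⌊n⌋₊))]
    exact mul_mem_expSpan (Submodule.sub_mem _ (kernel_mem_expSpan _) one_mem_expSpan)
      (hasseDeriv_succ_mem_expSpan (derivative_kernel_mem _) i)

/-- Skew-symmetry moves c to the left in (a • b) • c and in b • c; what remains is the commutator of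
the operators of a and c applied to b. -/
theorem mode_kernel_assoc (hg : IsAutomorphism g) (hT : 0 < T) (hgT : g ^ T = 1)
    (hn : ∃ k : ℕ, n = k / T) {a b c : V} (ha : a ∈ gradedPiece g T 0)
    (hc : c ∈ gradedPiece g T 0) :
    mode (kernel ⌊n⌋₊) (mode (kernel ⌊n⌋₊) a b) c -
      mode (kernel ⌊n⌋₊) a (mode (kernel ⌊n⌋₊) b c) ∈ OTilde g T n := by
  have h1 := rangeD_le_OTilde (g := g) (T := T) (n := n)
    (mode_kernel_skew ⌊n⌋₊ (mode (kernel ⌊n⌋₊) a b) c)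
  have h2 := mode_kernel_mem_OTilde hg hT hgT hn ha
    (rangeD_le_OTilde (g := g) (T := T) (n := n) (mode_kernel_skew ⌊n⌋₊ b c))
  have h3 := mode_kernel_commutator_mem hg hT hn ha hc b
  simp only [map_sub, LinearMap.sub_apply] at h2 h3
  convert Submodule.sub_mem _ (Submodule.sub_mem _ h1 h2) h3 using 1
  abel

/-! ### The product on the quotient. -/

/-- The operation `•` as a bilinear map. -/
def bulletLinear (g : V ≃ₗ[ℂ] V) (T : ℕ) (n : ℚ) : V →ₗ[ℂ] V →ₗ[ℂ] V :=
  mode (kernel ⌊n⌋₊) ∘ₗ proj g T 0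

theorem bulletLinear_apply (u v : V) : bulletLinear g T n u v = bullet g T n u v := by
  rw [bullet, bulletHom_eq]
  rfl

theorem proj_zero_mem_OTilde (hT : 0 < T) (hgT : g ^ T = 1) {u : V} (hu : u ∈ OTilde g T n) :
    proj g T 0 u ∈ OTilde g T n :=
  (Submodule.sub_mem_iff_right _ hu).mp (sub_proj_mem_OTilde hT hgT u)

theorem bulletLinear_mem_of_right (hg : IsAutomorphism g) (hT : 0 < T) (hgT : g ^ T = 1)
    (hn : ∃ k : ℕ, n = k / T) (u : V) {x : V} (hx : x ∈ OTilde g T n) :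
    bulletLinear g T n u x ∈ OTilde g T n :=
  mode_kernel_mem_OTilde hg hT hgT hn (proj_mem g hgT 0 u) hx

theorem bulletLinear_mem_of_left (hg : IsAutomorphism g) (hT : 0 < T) (hgT : g ^ T = 1)
    (hn : ∃ k : ℕ, n = k / T) {x : V} (hx : x ∈ OTilde g T n) (v : V) :
    bulletLinear g T n x v ∈ OTilde g T n := by
  -- Skew-symmetry needs the second factor in V^0, so v is first replaced by its V^0-component.
  have h1 := bulletLinear_mem_of_right hg hT hgT hn x (sub_proj_mem_OTilde (n := n) hT hgT v)
  have h2 := mode_kernel_mem_OTilde_of_left_mem hg hT hgT hn (proj_mem g hgT 0 v)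
    (proj_zero_mem_OTilde hT hgT hx)
  rw [map_sub] at h1
  exact (Submodule.sub_mem_iff_left _ h2).mp h1

/-- The product of `Ã` induced by `•`. -/
def mulATilde (hg : IsAutomorphism g) (hT : 0 < T) (hgT : g ^ T = 1)
    (hn : ∃ k : ℕ, n = k / T) : ATilde g T n →ₗ[ℂ] ATilde g T n →ₗ[ℂ] ATilde g T n :=
  (OTilde g T n).liftQ
    { toFun := fun u => (OTilde g T n).mapQ (OTilde g T n) (bulletLinear g T n u)
        fun _ hx => bulletLinear_mem_of_right hg hT hgT hn u hx
      map_add' := fun u v => by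
        ext w
        simp
      map_smul' := fun c u => by
        ext w
        simp }
    fun x hx => by
      rw [LinearMap.mem_ker]
      ext w
      simpa using bulletLinear_mem_of_left hg hT hgT hn hx w

theorem mulATilde_mkQ (hg : IsAutomorphism g) (hT : 0 < T) (hgT : g ^ T = 1)
    (hn : ∃ k : ℕ, n = k / T) (u v : V) :
    mulATilde hg hT hgT hn ((OTilde g T n).mkQ u) ((OTilde g T n).mkQ v) =
      (OTilde g T n).mkQ (bulletLinear g T n u v) := rfl

theorem exists_mkQ_eq (hT : 0 < T) (hgT : g ^ T = 1) (a : ATilde g T n) :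
    ∃ u ∈ gradedPiece g T 0, (OTilde g T n).mkQ u = a := by
  obtain ⟨u, rfl⟩ := (OTilde g T n).mkQ_surjective a
  refine ⟨proj g T 0 u, proj_mem g hgT 0 u, Eq.symm ?_⟩
  rw [← sub_eq_zero, ← map_sub, ← LinearMap.mem_ker, Submodule.ker_mkQ]
  exact sub_proj_mem_OTilde hT hgT u

theorem bulletLinear_of_mem (hT : 0 < T) {u : V} (hu : u ∈ gradedPiece g T 0) (v : V) :
    bulletLinear g T n u v = mode (kernel ⌊n⌋₊) u v := by
  rw [bulletLinear, LinearMap.comp_apply, proj_of_mem g hT hT hu, if_pos rfl]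

end

end VertexAlgebra
end

theorem theorem3p4 {V : Type*} [AddCommGroup V] [Module ℂ V] [VertexAlgebra V]
    (g : V ≃ₗ[ℂ] V) (hg : VertexAlgebra.IsAutomorphism g)
    (T : ℕ) (hT : 0 < T) (horder : orderOf g = T)
    (n : ℚ) (hn : ∃ k : ℕ, n = k / T) :
    ∃ mul : VertexAlgebra.ATilde g T n →ₗ[ℂ]
        VertexAlgebra.ATilde g T n →ₗ[ℂ] VertexAlgebra.ATilde g T n,
      (∀ u v : V, mul ((VertexAlgebra.OTilde g T n).mkQ u) ((VertexAlgebra.OTilde g T n).mkQ v) =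
        (VertexAlgebra.OTilde g T n).mkQ (VertexAlgebra.bullet g T n u v)) ∧
      (∀ a b c : VertexAlgebra.ATilde g T n, mul (mul a b) c = mul a (mul b c)) ∧
      (∀ a : VertexAlgebra.ATilde g T n,
        mul ((VertexAlgebra.OTilde g T n).mkQ VertexAlgebra.vac) a = a ∧
        mul a ((VertexAlgebra.OTilde g T n).mkQ VertexAlgebra.vac) = a) := by
  open VertexAlgebra in
  have hgT : g ^ T = 1 := horder ▸ pow_orderOf_eq_one g
  refine ⟨mulATilde hg hT hgT hn, fun u v => ?_, fun a b c => ?_, fun a => ?_⟩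
  · rw [mulATilde_mkQ, bulletLinear_apply]
  · obtain ⟨a, ha, rfl⟩ := exists_mkQ_eq hT hgT a
    obtain ⟨b, hb, rfl⟩ := exists_mkQ_eq hT hgT b
    obtain ⟨c, hc, rfl⟩ := exists_mkQ_eq hT hgT c
    simp only [mulATilde_mkQ]
    -- All classes have representatives in V^0, which is closed under the product, so the projection
    -- in `•` disappears.
    rw [bulletLinear_of_mem hT ha, bulletLinear_of_mem hT ha, bulletLinear_of_mem hT hb,
      bulletLinear_of_mem hT (mode_mem_gradedPiece hg ha hb _), ← sub_eq_zero, ← map_sub,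
      ← LinearMap.mem_ker, Submodule.ker_mkQ]
    exact mode_kernel_assoc hg hT hgT hn ha hc
  · obtain ⟨a, ha, rfl⟩ := exists_mkQ_eq hT hgT a
    rw [mulATilde_mkQ, mulATilde_mkQ, bulletLinear_of_mem hT (vac_mem_gradedPiece hg),
      bulletLinear_of_mem hT ha, mode_vac_left, coeff_neg_one_kernel, one_smul]
    refine ⟨rfl, ?_⟩
    have h := mode_vac_right (kernel ⌊n⌋₊) a
    rw [coeff_neg_one_kernel, one_smul] at h
    rw [← sub_eq_zero, ← map_sub, ← LinearMap.mem_ker, Submodule.ker_mkQ]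
    exact rangeD_le_OTilde h
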